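/- For $\ell\in\{0,1,2,\dots\}$ let $CM_\ell$ be the set of continuous functions $\psi:[0,\infty)\to\mathbb R$ that are $C^\infty$ on $(0,\infty)$ and for which $(-1)^\ell\psi^{(\ell)}$ is completely monotone on $(0,\infty)$ (a function $f$ is completely monotone on $(0,\infty)$ if it is $C^\infty$ there and $(-1)^n f^{(n)}\ge 0$ for all $n\ge 0$). For a real or complex Hilbert space $\mathcal H$ let $\mathfrak M(\mathcal H)$ be the set of scalar (real or complex) Borel measures $\mu$ on $\mathcal H$ of bounded variation whose variation $|\mu|$ is a Radon measure, i.e. finite on compact sets, inner regular with respect to compact sets and outer regular with respect to open sets on every Borel set. Theorem. Let $\mathcal H\neq\{0\}$ be a real or complex Hilbert space, $\ell\in\{0,1,2,\dots\}$, $\varphi,\phi\in CM_\ell$ and $\psi:=\varphi-\phi$. (1) Suppose that $\mathcal H$ is infinite-dimensional, and let $\mu\in\mathfrak M(\mathcal H)$ be such that $\|x\|^{2\ell}\in L^1(|\mu|)$. If $$\int_{\mathcal H}\psi(\|x-y\|^2)\,d\mu(x)=0\quad\text{for all } y\in\mathcal H,$$ then $$\int_{\mathcal H}\psi(\|x-y\|^2+c)\,d\mu(x)=0\quad\text{for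 all } y\in\mathcal H \text{ and } c\ge 0.$$ (2) In any (finite or infinite) dimension, $\psi$ is not a polynomial on $[0,\infty)$ if and only if the only measure $\mu\in\mathfrak M(\mathcal H)$ with $\|x\|^{2\ell}\in L^1(|\mu|)$ and $$\int_{\mathcal H}\psi(\|x-y\|^2+c)\,d\mu(x)=0\quad\text{for all } y\in\mathcal H \text{ and } c\ge 0$$ is the zero measure. -/

import Mathlib

open MeasureTheory Set
open scoped ContDiff

/-- A function `f : ℝ → ℝ` is completely monotone on `s` (here always the open half-line `(0, ∞)`)
if it is smooth there and `(-1)ⁿ f⁽ⁿ⁾ ≥ 0` on `s` for every `n`. -/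
def CompletelyMonotoneOn (f : ℝ → ℝ) (s : Set ℝ) : Prop :=
  ContDiffOn ℝ ∞ f s ∧ ∀ n : ℕ, ∀ t ∈ s, 0 ≤ (-1 : ℝ) ^ n * iteratedDerivWithin n f s t

/-- The class `CM_ℓ` of continuous functions `[0, ∞) → ℝ` that are smooth on `(0, ∞)` and for which
`(-1)^ℓ ψ^(ℓ)` is completely monotone on `(0, ∞)`. Only the values of `ψ` on `[0, ∞)` matter. -/
structure IsCM (ℓ : ℕ) (ψ : ℝ → ℝ) : Prop where
  continuousOn : ContinuousOn ψ (Ici 0)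
  contDiffOn : ContDiffOn ℝ ∞ ψ (Ioi 0)
  completelyMonotone :
    CompletelyMonotoneOn (fun t => (-1 : ℝ) ^ ℓ * iteratedDerivWithin ℓ ψ (Ioi 0) t) (Ioi 0)

/-- `ψ` agrees on `[0, ∞)` with a real polynomial. -/
def IsPolynomialOnNonneg (ψ : ℝ → ℝ) : Prop :=
  ∃ p : Polynomial ℝ, ∀ t : ℝ, 0 ≤ t → ψ t = p.eval t

/-- A nonnegative Borel measure is Radon if it is finite on compact sets, inner regular with respect
to compact sets on all Borel sets, and outer regular with respect to open sets on all Borel sets. -/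
structure IsRadonMeasure {X : Type*} [TopologicalSpace X] [MeasurableSpace X]
    (m : Measure X) : Prop where
  finiteOnCompacts : IsFiniteMeasureOnCompacts m
  innerRegular : m.InnerRegular
  outerRegular : m.OuterRegular

/-- Membership in `𝔐(X)`: a scalar (real or complex) measure of bounded variation whose
variation is a Radon measure. -/
structure IsBoundedRadon {X 𝕂 : Type*} [TopologicalSpace X] [MeasurableSpace X] [RCLike 𝕂]
    (μ : VectorMeasure X 𝕂) : Prop where
  boundedVariation : IsFiniteMeasure μ.variation
  radon : IsRadonMeasure μ.variation

/-! Part (1): if `v n` is orthonormal, Bessel's inequality makes `⟪z, v n⟫` tend to 0. Moving `y` by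
`√c • v n` therefore turns `‖x - y‖ ^ 2` into `‖x - y‖ ^ 2 + c` in the limit. Functions in the class
are `O(t ^ ℓ)` (`HasAlternatingDerivs.exists_abs_le`), so the moment hypothesis gives dominated
convergence.

Part (2), uniqueness: a nonzero `μ` has a nonzero real component, whose Jordan parts `P ≠ Q` give
equal integrals of all the functions `ψ (‖x - y‖ ^ 2 + c)`. For `ℓ = 0`, Hausdorff moments and
Bernstein's theorem write `φ` and `ϕ` on `(0, ∞)` as `∫ u ^ t` against finite measures `ν₁`, `ν₂` on
`[0, 1]`. The shifts `c = k + 1` say that `ν₁` and `ν₂`, weighted by `W y u = ∫ u ^ (‖x - y‖ ^ 2 +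
1) d(P - Q)`, have equal moments, so `ν₁ = ν₂` wherever `W y ≠ 0`. For `0 < u < 1` the kernel is a
Gaussian in `x`, and Gaussian integrals determine a finite measure on a Hilbert space with separable
carrier; hence some `W y u ≠ 0`. So `ν₁ = ν₂` on `(0, 1)`, and the endpoints contribute only a
constant to `ψ`. For larger `ℓ`, induct on the differences `ψ t - ψ (t + a)`, which belong to the
class of order one less: the `ℓ`-th derivative of `ψ` is constant and `ψ` is a polynomial.

Part (2), converse: a polynomial in `‖x - y‖ ^ 2` restricted to a line is a polynomial of bounded
degree, so a high-order finite difference along the line annihilates it. -/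

/-- `φ` is continuous on `[0, ∞)`, smooth on `(0, ∞)`, and its derivatives of order at least `ℓ`
have alternating signs. -/
structure HasAlternatingDerivs (ℓ : ℕ) (φ : ℝ → ℝ) : Prop where
  continuousOn : ContinuousOn φ (Ici 0)
  contDiffOn : ContDiffOn ℝ ∞ φ (Ioi 0)
  sign : ∀ m, ℓ ≤ m → ∀ t, 0 < t → 0 ≤ (-1 : ℝ) ^ m * iteratedDeriv m φ t

theorem IsCM.hasAlternatingDerivs {ℓ : ℕ} {φ : ℝ → ℝ} (h : IsCM ℓ φ) :
    HasAlternatingDerivs ℓ φ where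
  continuousOn := h.continuousOn
  contDiffOn := h.contDiffOn
  sign m hm t ht := by
    obtain ⟨n, rfl⟩ := Nat.exists_eq_add_of_le' hm
    have key := h.completelyMonotone.2 n t ht
    rw [iteratedDerivWithin_of_isOpen isOpen_Ioi ht] at key
    have hev : (fun t => (-1 : ℝ) ^ ℓ * iteratedDerivWithin ℓ φ (Ioi 0) t) =ᶠ[nhds t]
        fun t => (-1 : ℝ) ^ ℓ * iteratedDeriv ℓ φ t := by
      filter_upwards [isOpen_Ioi.mem_nhds ht] with s hs
      rw [iteratedDerivWithin_of_isOpen isOpen_Ioi hs]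
    rw [hev.iteratedDeriv_eq, iteratedDeriv_const_mul_field] at key
    have h2 : iteratedDeriv n (fun t => iteratedDeriv ℓ φ t) t = iteratedDeriv (n + ℓ) φ t := by
      simp only [iteratedDeriv_eq_iterate, Function.iterate_add, Function.comp]
    rw [h2] at key
    rw [pow_add, mul_assoc]
    exact key

theorem ContDiffOn.contDiffAt_of_pos {φ : ℝ → ℝ} (h : ContDiffOn ℝ ∞ φ (Ioi 0)) {t : ℝ} (ht : 0 < t)
    (n : ℕ) : ContDiffAt ℝ n φ t :=
  (h.contDiffAt (isOpen_Ioi.mem_nhds ht)).of_le (mod_cast le_top)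

theorem ContDiffOn.differentiableAt_iteratedDeriv_of_pos {φ : ℝ → ℝ} (h : ContDiffOn ℝ ∞ φ (Ioi 0))
    {t : ℝ} (ht : 0 < t) (n : ℕ) : DifferentiableAt ℝ (iteratedDeriv n φ) t := by
  have h1 : DifferentiableOn ℝ (iteratedDerivWithin n φ (Ioi 0)) (Ioi 0) :=
    h.differentiableOn_iteratedDerivWithin (mod_cast WithTop.coe_lt_top _) isOpen_Ioi.uniqueDiffOn
  refine ((h1 t ht).differentiableAt (isOpen_Ioi.mem_nhds ht)).congr_of_eventuallyEq ?_
  filter_upwards [isOpen_Ioi.mem_nhds ht] with s hs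
  rw [iteratedDerivWithin_of_isOpen isOpen_Ioi hs]

theorem ContDiffOn.comp_add_const_of_pos {φ : ℝ → ℝ} (h : ContDiffOn ℝ ∞ φ (Ioi 0)) {a : ℝ}
    (ha : 0 ≤ a) : ContDiffOn ℝ ∞ (fun t => φ (t + a)) (Ioi 0) :=
  h.comp (by fun_prop) fun t ht => by
    have : 0 < t := ht
    show 0 < t + a
    positivity

theorem iteratedDeriv_sub_comp_add_const {φ : ℝ → ℝ} (h : ContDiffOn ℝ ∞ φ (Ioi 0)) {a t : ℝ}
    (ha : 0 ≤ a) (ht : 0 < t) (n : ℕ) :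
    iteratedDeriv n (fun t => φ t - φ (t + a)) t =
      iteratedDeriv n φ t - iteratedDeriv n φ (t + a) := by
  rw [iteratedDeriv_fun_sub (h.contDiffAt_of_pos ht n)
    ((h.comp_add_const_of_pos ha).contDiffAt_of_pos ht n), iteratedDeriv_comp_add_const]

theorem ContinuousOn.sub_comp_add_const {φ : ℝ → ℝ} (h : ContinuousOn φ (Ici 0)) {a : ℝ}
    (ha : 0 ≤ a) : ContinuousOn (fun t => φ t - φ (t + a)) (Ici 0) :=
  h.sub (h.comp (by fun_prop) fun t ht => by
    have : 0 ≤ t := ht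
    show 0 ≤ t + a
    positivity)

/-! ### Differencing and polynomial growth -/

namespace HasAlternatingDerivs

variable {ℓ : ℕ} {φ : ℝ → ℝ}

theorem mono (h : HasAlternatingDerivs ℓ φ) {k : ℕ} (hk : ℓ ≤ k) : HasAlternatingDerivs k φ :=
  ⟨h.continuousOn, h.contDiffOn, fun m hm => h.sign m (hk.trans hm)⟩

theorem antitoneOn (h : HasAlternatingDerivs (ℓ + 1) φ) {m : ℕ} (hm : ℓ ≤ m) :
    AntitoneOn (fun t => (-1 : ℝ) ^ m * iteratedDeriv m φ t) (Ioi 0) := by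
  have hd : ∀ t ∈ Ioi (0 : ℝ), DifferentiableAt ℝ (iteratedDeriv m φ) t := fun t ht =>
    h.contDiffOn.differentiableAt_iteratedDeriv_of_pos ht m
  refine antitoneOn_of_deriv_nonpos (convex_Ioi 0)
    (fun t ht => ((hd t ht).const_mul _).continuousAt.continuousWithinAt) ?_ ?_
  · rw [interior_Ioi]
    exact fun t ht => ((hd t ht).const_mul _).differentiableWithinAt
  · rw [interior_Ioi]
    intro t ht
    rw [deriv_const_mul _ (hd t ht), ← iteratedDeriv_succ]
    have := h.sign (m + 1) (by omega) t ht
    rw [pow_succ] at this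
    linarith

/-- Each signed derivative is decreasing, so its difference over a step `a` is nonnegative. This
trades one order for one difference and drives the inductions on `ℓ`. -/
theorem sub_comp_add_const (h : HasAlternatingDerivs (ℓ + 1) φ) {a : ℝ} (ha : 0 ≤ a) :
    HasAlternatingDerivs ℓ fun t => φ t - φ (t + a) where
  continuousOn := h.continuousOn.sub_comp_add_const ha
  contDiffOn := h.contDiffOn.sub (h.contDiffOn.comp_add_const_of_pos ha)
  sign m hm t ht := by
    rw [iteratedDeriv_sub_comp_add_const h.contDiffOn ha ht, mul_sub, sub_nonneg]
    exact h.antitoneOn hm ht (show 0 < t + a by positivity) (by linarith)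

theorem nonneg (h : HasAlternatingDerivs 0 φ) {t : ℝ} (ht : 0 ≤ t) : 0 ≤ φ t := by
  have hpos : ∀ s, 0 < s → 0 ≤ φ s := fun s hs => by simpa using h.sign 0 le_rfl s hs
  rcases ht.eq_or_lt with rfl | ht
  · have h0 := (h.continuousOn 0 self_mem_Ici).mono_left
      (nhdsWithin_mono 0 (Ioi_subset_Ici_self (a := (0 : ℝ))))
    exact ge_of_tendsto h0 (eventually_nhdsWithin_of_forall hpos)
  · exact hpos t ht

theorem le_apply_zero (h : HasAlternatingDerivs 0 φ) {t : ℝ} (ht : 0 ≤ t) : φ t ≤ φ 0 := by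
  simpa using ((h.mono (Nat.zero_le 1)).sub_comp_add_const ht).nonneg le_rfl

/-- A function whose derivatives of order at least `ℓ` alternate in sign is `O(t ^ ℓ)`. -/
theorem exists_abs_le : ∀ {ℓ : ℕ} {φ : ℝ → ℝ}, HasAlternatingDerivs ℓ φ →
    ∃ C, 0 ≤ C ∧ ∀ t, 0 ≤ t → |φ t| ≤ C * (1 + t) ^ ℓ
  | 0, φ, h => ⟨φ 0, h.nonneg le_rfl, fun t ht => by
      rw [abs_of_nonneg (h.nonneg ht)]; simpa using h.le_apply_zero ht⟩
  | ℓ + 1, φ, h => by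
    obtain ⟨C, hC0, hC⟩ := exists_abs_le (h.sub_comp_add_const zero_le_one)
    obtain ⟨M, hM⟩ := isCompact_Icc.exists_bound_of_continuousOn
      (h.continuousOn.mono (Icc_subset_Ici_self : Icc (0 : ℝ) 1 ⊆ _))
    have hM0 : 0 ≤ M := (norm_nonneg _).trans (hM 0 (by simp))
    -- Walk down from `t` in unit steps until `[0, 1]`, where `M` bounds `φ`. There are at most `t`
    -- steps, each costing at most `C * (1 + t) ^ ℓ`; `n` only drives the induction.
    have step : ∀ n : ℕ, ∀ t : ℝ, 0 ≤ t → t ≤ n + 1 → |φ t| ≤ M + t * (C * (1 + t) ^ ℓ) := by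
      intro n
      induction n with
      | zero =>
        intro t ht ht1
        have := hM t ⟨ht, by simpa using ht1⟩
        rw [Real.norm_eq_abs] at this
        have : 0 ≤ t * (C * (1 + t) ^ ℓ) := by positivity
        linarith
      | succ n ih =>
        intro t ht ht1
        rcases le_total t 1 with h1 | h1
        · have := hM t ⟨ht, h1⟩
          rw [Real.norm_eq_abs] at this
          have : 0 ≤ t * (C * (1 + t) ^ ℓ) := by positivity
          linarith
        · have e1 := ih (t - 1) (by linarith) (by push_cast at ht1; linarith)
          have e2 := hC (t - 1) (by linarith)
          simp only [sub_add_cancel, add_sub_cancel] at e1 e2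
          have e3 : |φ t| ≤ |φ (t - 1)| + |φ (t - 1) - φ t| := by
            have := abs_sub_abs_le_abs_sub (φ t) (φ (t - 1))
            rw [abs_sub_comm (φ (t - 1)) (φ t)]
            linarith
          have e4 : t ^ ℓ ≤ (1 + t) ^ ℓ := by gcongr; linarith
          calc |φ t| ≤ M + (t - 1) * (C * t ^ ℓ) + C * t ^ ℓ := by linarith
            _ = M + t * (C * t ^ ℓ) := by ring
            _ ≤ _ := by gcongr
    refine ⟨M + C, by positivity, fun t ht => ?_⟩
    obtain ⟨n, hn⟩ := exists_nat_ge t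
    have e1 := step n t ht (by linarith)
    have e2 : (1 : ℝ) ≤ (1 + t) ^ (ℓ + 1) := one_le_pow₀ (by linarith)
    calc |φ t| ≤ M * 1 + t * (C * (1 + t) ^ ℓ) := by linarith
      _ ≤ M * (1 + t) ^ (ℓ + 1) + (1 + t) * (C * (1 + t) ^ ℓ) := by gcongr; linarith
      _ = _ := by ring

end HasAlternatingDerivs

/-! ### Functions with a constant derivative of some order -/

theorem Polynomial.exists_derivative_eq {R : Type*} [Field R] [CharZero R] (p : Polynomial R) :
    ∃ q : Polynomial R, q.derivative = p := by
  induction p using Polynomial.induction_on' with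
  | add p q hp hq =>
    obtain ⟨p', rfl⟩ := hp
    obtain ⟨q', rfl⟩ := hq
    exact ⟨p' + q', by simp⟩
  | monomial n c =>
    refine ⟨Polynomial.monomial (n + 1) (c / (n + 1)), ?_⟩
    rw [Polynomial.derivative_monomial]
    have : (n : R) + 1 ≠ 0 := n.cast_add_one_ne_zero
    simp [this]

theorem isPolynomialOnNonneg_of_iteratedDeriv_const : ∀ {ℓ : ℕ} {ψ : ℝ → ℝ} {a : ℝ},
    ContinuousOn ψ (Ici 0) → ContDiffOn ℝ ∞ ψ (Ioi 0) → (∀ t, 0 < t → iteratedDeriv ℓ ψ t = a) →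
    IsPolynomialOnNonneg ψ := by
  intro ℓ ψ a hc hs h
  -- Integrate one order at a time on `(0, ∞)`; continuity then brings in the point 0.
  have : ∀ k, k ≤ ℓ → ∃ p : Polynomial ℝ, ∀ t, 0 < t → iteratedDeriv (ℓ - k) ψ t = p.eval t := by
    intro k
    induction k with
    | zero => exact fun _ => ⟨Polynomial.C a, fun t ht => by simpa using h t ht⟩
    | succ k ih =>
      intro hk
      obtain ⟨p, hp⟩ := ih (by omega)
      obtain ⟨q, hq⟩ := p.exists_derivative_eq
      have hd : ∀ t ∈ Ioi (0 : ℝ), HasDerivAt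
          (fun t => iteratedDeriv (ℓ - (k + 1)) ψ t - q.eval t) 0 t := fun t ht => by
        have h1 := (hs.differentiableAt_iteratedDeriv_of_pos ht (ℓ - (k + 1))).hasDerivAt
        rw [← iteratedDeriv_succ, show ℓ - (k + 1) + 1 = ℓ - k by omega, hp t ht, ← hq] at h1
        have h2 := h1.sub (q.hasDerivAt t)
        rwa [sub_self] at h2
      obtain ⟨b, hb⟩ := isOpen_Ioi.exists_is_const_of_deriv_eq_zero (convex_Ioi 0).isPreconnected
        (fun t ht => (hd t ht).differentiableAt.differentiableWithinAt)
        (fun t ht => (hd t ht).deriv)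
      refine ⟨q + Polynomial.C b, fun t ht => ?_⟩
      have := hb t ht
      simp only [Polynomial.eval_add, Polynomial.eval_C]
      linarith
  obtain ⟨p, hp⟩ := this ℓ le_rfl
  refine ⟨p, fun t ht => ?_⟩
  have hcl : EqOn ψ (fun t => p.eval t) (Ici 0) := by
    refine EqOn.of_subset_closure (s := Ioi 0) (fun t ht => ?_) hc p.continuous.continuousOn
      Ioi_subset_Ici_self (by rw [closure_Ioi])
    simpa using hp t ht
  exact hcl ht

/-! ### The Hausdorff moment problem -/

open Polynomial in
/-- The linear functional on polynomials sending `X ^ k` to `a k`. -/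
noncomputable def momentFunctional (a : ℕ → ℝ) : ℝ[X] →ₗ[ℝ] ℝ :=
  Polynomial.lsum fun k => a k • LinearMap.id

section Hausdorff
open Polynomial

theorem momentFunctional_X_pow (a : ℕ → ℝ) (k : ℕ) : momentFunctional a (X ^ k) = a k := by
  simp [momentFunctional, Polynomial.lsum_apply, ← Polynomial.monomial_one_right_eq_X_pow]

/-- The backward difference of a sequence. -/
def seqDiff (a : ℕ → ℝ) : ℕ → ℝ := fun k => a k - a (k + 1)

theorem momentFunctional_X_pow_mul_one_sub_X_pow (a : ℕ → ℝ) (m k : ℕ) :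
    momentFunctional a (X ^ k * (1 - X) ^ m) = seqDiff^[m] a k := by
  induction m generalizing k with
  | zero => simp [momentFunctional_X_pow]
  | succ m ih =>
    rw [Function.iterate_succ_apply', seqDiff, ← ih, ← ih, ← map_sub]
    congr 1
    ring

theorem momentFunctional_bernsteinPolynomial_nonneg {a : ℕ → ℝ} (ha : ∀ m k, 0 ≤ seqDiff^[m] a k)
    (n k : ℕ) : 0 ≤ momentFunctional a (bernsteinPolynomial ℝ n k) := by
  have : bernsteinPolynomial ℝ n k = (n.choose k : ℝ) • (X ^ k * (1 - X) ^ (n - k)) := by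
    rw [bernsteinPolynomial, Polynomial.smul_eq_C_mul]
    simp [mul_assoc]
  rw [this, map_smul, momentFunctional_X_pow_mul_one_sub_X_pow]
  exact mul_nonneg (Nat.cast_nonneg _) (ha _ _)

/-- By `choose n k * choose k j = choose n j * choose (n - j) (k - j)`, the factor `X ^ j` splits
off and leaves the Bernstein partition of unity of degree `n - j`. -/
theorem sum_choose_smul_bernsteinPolynomial {n j : ℕ} (hj : j ≤ n) :
    ∑ k ∈ Finset.range (n + 1), (k.choose j : ℝ) • bernsteinPolynomial ℝ n k =
      (n.choose j : ℝ) • X ^ j := by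
  obtain ⟨d, rfl⟩ := Nat.exists_eq_add_of_le hj
  rw [add_assoc, Finset.sum_range_add]
  have h0 : ∑ k ∈ Finset.range j, (k.choose j : ℝ) • bernsteinPolynomial ℝ (j + d) k = 0 :=
    Finset.sum_eq_zero fun k hk => by
      rw [Nat.choose_eq_zero_of_lt (Finset.mem_range.1 hk)]; simp
  rw [h0, zero_add]
  have h1 : ∀ k ∈ Finset.range (d + 1),
      ((j + k).choose j : ℝ) • bernsteinPolynomial ℝ (j + d) (j + k) =
        ((j + d).choose j : ℝ) • (X ^ j * bernsteinPolynomial ℝ d k) := by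
    intro k hk
    have hk' : k ≤ d := Nat.lt_succ_iff.1 (Finset.mem_range.1 hk)
    have hc := Nat.choose_mul (n := j + d) (k := j + k) (s := j) (by omega)
    rw [show j + d - j = d by omega, show j + k - j = k by omega] at hc
    have hc' : (((j + d).choose (j + k) : ℕ) : ℝ[X]) * (((j + k).choose j : ℕ) : ℝ[X]) =
      (((j + d).choose j : ℕ) : ℝ[X]) * ((d.choose k : ℕ) : ℝ[X]) := by exact_mod_cast hc
    simp only [bernsteinPolynomial, Polynomial.smul_eq_C_mul, map_natCast]
    rw [show j + d - (j + k) = d - k by omega, pow_add]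
    linear_combination X ^ j * X ^ k * (1 - X) ^ (d - k) * hc'
  rw [Finset.sum_congr rfl h1, ← Finset.smul_sum, ← Finset.mul_sum, bernsteinPolynomial.sum, mul_one]

/-- Each new factor `(k - j) / (n - j)` is within `j / n` of `k / n`, and all factors lie in `[0,
1]`, so the errors add up. Uniformity in `k` is what makes the moments of the discrete measures
converge. -/
theorem abs_descFactorial_div_sub_pow_le {n k : ℕ} (hk : k ≤ n) {j : ℕ} (hj : j ≤ n) :
    |(k.descFactorial j : ℝ) / n.descFactorial j - ((k : ℝ) / n) ^ j| ≤ (j : ℝ) * j / n := by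
  induction j with
  | zero => simp
  | succ j ih =>
    have ih := ih (by omega)
    have hn : (0 : ℝ) < n := by exact_mod_cast (by omega : 0 < n)
    have hnj : (0 : ℝ) < ((n - j : ℕ) : ℝ) := by exact_mod_cast (by omega : 0 < n - j)
    set r : ℝ := (k.descFactorial j : ℝ) / n.descFactorial j
    set x : ℝ := (k : ℝ) / n
    have hx0 : 0 ≤ x := by positivity
    have hx1 : x ≤ 1 := div_le_one_of_le₀ (by exact_mod_cast hk) hn.le
    set s : ℝ := ((k - j : ℕ) : ℝ) / ((n - j : ℕ) : ℝ)
    have hs0 : 0 ≤ s := by positivity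
    have hs1 : s ≤ 1 := div_le_one_of_le₀ (by exact_mod_cast Nat.sub_le_sub_right hk j) hnj.le
    have hr : (k.descFactorial (j + 1) : ℝ) / n.descFactorial (j + 1) = s * r := by
      rw [Nat.descFactorial_succ, Nat.descFactorial_succ]
      push_cast
      rw [mul_div_mul_comm]
    have hsx : |s - x| ≤ j / n := by
      rcases le_total j k with hjk | hjk
      · have e : s - x = -(j * (n - k) / (n * ((n - j : ℕ) : ℝ))) := by
          simp only [s, x, Nat.cast_sub hjk, Nat.cast_sub (by omega : j ≤ n)] at hnj ⊢
          field_simp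
          ring
        have hkn : (k : ℝ) ≤ n := by exact_mod_cast hk
        have hjk' : (j : ℝ) ≤ k := by exact_mod_cast hjk
        have : (0 : ℝ) ≤ n - k := by linarith
        rw [e, abs_neg, abs_of_nonneg (by positivity), div_le_div_iff₀ (by positivity) hn,
          Nat.cast_sub (by omega : j ≤ n)]
        have : (j : ℝ) * n * (n - k) ≤ j * n * (n - j) := by gcongr
        linarith
      · have : s = 0 := by simp [s, Nat.sub_eq_zero_of_le hjk]
        rw [this, zero_sub, abs_neg, abs_of_nonneg hx0]
        simp only [x]
        gcongr
    rw [hr]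
    calc |s * r - x ^ (j + 1)| = |s * (r - x ^ j) + x ^ j * (s - x)| := by congr 1; ring
      _ ≤ |s * (r - x ^ j)| + |x ^ j * (s - x)| := abs_add_le _ _
      _ = s * |r - x ^ j| + x ^ j * |s - x| := by
        rw [abs_mul, abs_mul, abs_of_nonneg hs0, abs_of_nonneg (pow_nonneg hx0 j)]
      _ ≤ 1 * ((j : ℝ) * j / n) + 1 * (j / n) := by
        gcongr
        exact pow_le_one₀ hx0 hx1
      _ ≤ _ := by
        rw [one_mul, one_mul, ← add_div]
        gcongr
        push_cast
        nlinarith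

theorem sum_descFactorial_mul_momentFunctional (a : ℕ → ℝ) {n j : ℕ} (hj : j ≤ n) :
    ∑ k ∈ Finset.range (n + 1), ((k.descFactorial j : ℝ) / n.descFactorial j) *
      momentFunctional a (bernsteinPolynomial ℝ n k) = a j := by
  have h := congrArg (momentFunctional a) (sum_choose_smul_bernsteinPolynomial hj)
  rw [map_sum, map_smul, momentFunctional_X_pow] at h
  simp only [map_smul, smul_eq_mul] at h
  have hn : (n.choose j : ℝ) ≠ 0 := by exact_mod_cast (Nat.choose_pos hj).ne'
  have hf : (j.factorial : ℝ) ≠ 0 := by exact_mod_cast j.factorial_ne_zero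
  rw [← mul_left_cancel_iff_of_pos (a := (n.choose j : ℝ)) (by positivity), ← h, Finset.mul_sum]
  refine Finset.sum_congr rfl fun k _ => ?_
  rw [Nat.descFactorial_eq_factorial_mul_choose, Nat.descFactorial_eq_factorial_mul_choose]
  push_cast
  field_simp

open Filter Topology unitInterval in
/-- The **Hausdorff moment problem**: a completely monotone sequence is the moment sequence of a
finite measure on the unit interval. -/
theorem exists_measure_moment_eq {a : ℕ → ℝ} (ha : ∀ m k, 0 ≤ seqDiff^[m] a k) :
    ∃ ν : Measure I, IsFiniteMeasure ν ∧ ∀ k : ℕ, a k = ∫ u : I, (u : ℝ) ^ k ∂ν := by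
  -- `L n k` is the mass to be placed at `k / n`; complete monotonicity is exactly what makes it
  -- nonnegative.
  set L : ℕ → ℕ → ℝ := fun n k => momentFunctional a (bernsteinPolynomial ℝ n k) with hLdef
  have hL0 : ∀ n k, 0 ≤ L n k := momentFunctional_bernsteinPolynomial_nonneg ha
  have hLsum : ∀ n, ∑ k ∈ Finset.range (n + 1), L n k = a 0 := fun n => by
    simpa using sum_descFactorial_mul_momentFunctional a (Nat.zero_le n)
  have hmom : ∀ j, Tendsto
      (fun n : ℕ => ∑ k ∈ Finset.range (n + 1), ((k : ℝ) / n) ^ j * L n k) atTop (𝓝 (a j)) := by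
    intro j
    have hb : Tendsto (fun n : ℕ => ((j : ℝ) * j * a 0) / n) atTop (𝓝 0) :=
      tendsto_const_div_atTop_nhds_zero_nat _
    refine tendsto_iff_norm_sub_tendsto_zero.2 (squeeze_zero' (.of_forall fun _ => norm_nonneg _)
      ?_ hb)
    filter_upwards [eventually_ge_atTop j] with n hn
    nth_rw 1 [← sum_descFactorial_mul_momentFunctional a hn]
    rw [← Finset.sum_sub_distrib, ← hLsum n, Finset.mul_sum, Finset.sum_div]
    refine (norm_sum_le _ _).trans (Finset.sum_le_sum fun k hk => ?_)
    rw [← sub_mul, norm_mul, Real.norm_eq_abs, abs_sub_comm, Real.norm_of_nonneg (hL0 n k),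
      mul_div_right_comm]
    exact mul_le_mul_of_nonneg_right (abs_descFactorial_div_sub_pow_le
      (Nat.lt_succ_iff.1 (Finset.mem_range.1 hk)) hn) (hL0 n k)
  have ha0 : 0 ≤ a 0 := ha 0 0
  rcases ha0.eq_or_lt with h0 | h0
  · refine ⟨0, inferInstance, fun j => ?_⟩
    have hz : ∀ n, ∀ k ∈ Finset.range (n + 1), L n k = 0 := fun n =>
      (Finset.sum_eq_zero_iff_of_nonneg fun k _ => hL0 n k).1 ((hLsum n).trans h0.symm)
    have : Tendsto (fun n : ℕ => (0 : ℝ)) atTop (𝓝 (a j)) := by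
      refine (hmom j).congr fun n => Finset.sum_eq_zero fun k hk => ?_
      rw [hz n k hk, mul_zero]
    simpa using tendsto_nhds_unique this tendsto_const_nhds
  · set pt : ℕ → ℕ → I := fun n k => projIcc 0 1 zero_le_one ((k : ℝ) / n)
    have hpt : ∀ n k, k ∈ Finset.range (n + 1) → ((pt n k : I) : ℝ) = (k : ℝ) / n := by
      intro n k hk
      have hkn : (k : ℝ) ≤ n := by exact_mod_cast Nat.lt_succ_iff.1 (Finset.mem_range.1 hk)
      have : (k : ℝ) / n ∈ Icc (0 : ℝ) 1 :=
        ⟨by positivity, div_le_one_of_le₀ hkn (Nat.cast_nonneg n)⟩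
      simp only [pt, projIcc_of_mem _ this]
    set M : ℕ → Measure I := fun n => ∑ k ∈ Finset.range (n + 1),
      ENNReal.ofReal (L n k / a 0) • Measure.dirac (pt n k)
    have hM : ∀ n, IsProbabilityMeasure (M n) := fun n => ⟨by
      simp only [M, Measure.finsetSum_apply, Measure.smul_apply, smul_eq_mul, measure_univ, mul_one]
      rw [← ENNReal.ofReal_sum_of_nonneg fun k _ => div_nonneg (hL0 n k) ha0, ← Finset.sum_div,
        hLsum, div_self h0.ne', ENNReal.ofReal_one]⟩
    set P : ℕ → ProbabilityMeasure I := fun n => ⟨M n, hM n⟩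
    -- Probability measures on a compact space form a compact space, so a limit along an ultrafilter
    -- exists without extracting a subsequence.
    set U : Ultrafilter ℕ := hyperfilter ℕ
    have hU : (U : Filter ℕ) ≤ atTop := Nat.hyperfilter_le_atTop
    obtain ⟨Q, hQ⟩ : ∃ Q, Tendsto P U (𝓝 Q) := ⟨(U.map P).lim, (U.map P).le_nhds_lim⟩
    rw [ProbabilityMeasure.tendsto_iff_forall_integral_tendsto] at hQ
    refine ⟨ENNReal.ofReal (a 0) • (Q : Measure I), Measure.smul_finite _ ENNReal.ofReal_ne_top,
      fun j => ?_⟩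
    have hj := hQ (BoundedContinuousFunction.mkOfCompact ⟨fun u : I => (u : ℝ) ^ j, by fun_prop⟩)
    simp only [BoundedContinuousFunction.mkOfCompact_apply, ContinuousMap.coe_mk] at hj
    have hint : ∀ n, ∫ u : I, (u : ℝ) ^ j ∂(P n : Measure I) =
        (∑ k ∈ Finset.range (n + 1), ((k : ℝ) / n) ^ j * L n k) / a 0 := by
      intro n
      show ∫ u : I, (u : ℝ) ^ j ∂(M n) = _
      rw [integral_finsetSum_measure fun k _ => ?_, Finset.sum_div]
      · refine Finset.sum_congr rfl fun k hk => ?_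
        rw [integral_smul_measure, integral_dirac, hpt n k hk,
          ENNReal.toReal_ofReal (div_nonneg (hL0 n k) ha0), smul_eq_mul]
        ring
      · exact (integrable_dirac (by simp)).smul_measure ENNReal.ofReal_ne_top
    simp only [hint] at hj
    have := tendsto_nhds_unique hj (((hmom j).mono_left hU).div_const _)
    rw [integral_smul_measure, this, ENNReal.toReal_ofReal ha0, smul_eq_mul]
    field_simp

end Hausdorff

/-! ### Bernstein's theorem -/

section Bernstein
open unitInterval

/-- Both sides are continuous in `g` for the sup norm, and polynomials are dense by Weierstrass. `W`
may change sign. -/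
theorem integral_mul_eq_of_moments_eq {ν₁ ν₂ : Measure I} [IsFiniteMeasure ν₁] [IsFiniteMeasure ν₂]
    {W : I → ℝ} (hW : Continuous W)
    (h : ∀ k : ℕ, ∫ u : I, (u : ℝ) ^ k * W u ∂ν₁ = ∫ u : I, (u : ℝ) ^ k * W u ∂ν₂) {g : I → ℝ}
    (hg : Continuous g) : ∫ u, g u * W u ∂ν₁ = ∫ u, g u * W u ∂ν₂ := by
  have hint : ∀ (ν : Measure I) [IsFiniteMeasure ν] (f : C(I, ℝ)),
      Integrable (fun u => f u * W u) ν := fun ν _ f =>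
    (f.continuous.mul hW).integrable_of_hasCompactSupport (HasCompactSupport.of_compactSpace _)
  obtain ⟨C, hC⟩ := isCompact_univ.exists_bound_of_continuousOn hW.continuousOn
  have hcont : ∀ (ν : Measure I) [IsFiniteMeasure ν],
      Continuous fun f : C(I, ℝ) => ∫ u, f u * W u ∂ν := by
    intro ν _
    let Λ : C(I, ℝ) →ₗ[ℝ] ℝ :=
      { toFun f := ∫ u, f u * W u ∂ν
        map_add' f₁ f₂ := by
          rw [← integral_add (hint ν f₁) (hint ν f₂)]
          simp only [ContinuousMap.add_apply, add_mul]
        map_smul' c f := by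
          simp only [ContinuousMap.smul_apply, smul_eq_mul, mul_assoc, integral_const_mul,
            RingHom.id_apply] }
    refine AddMonoidHomClass.continuous_of_bound Λ (C * ν.real univ) fun f => ?_
    refine (norm_integral_le_of_norm_le_const (C := ‖f‖ * C) (.of_forall fun u => ?_)).trans_eq
      (by ring)
    rw [norm_mul]
    gcongr
    · exact f.norm_coe_le_norm u
    · exact hC u (mem_univ u)
  have hdense : Dense (polynomialFunctions (Icc (0 : ℝ) 1) : Set C(I, ℝ)) := by
    rw [dense_iff_closure_eq, ← Subalgebra.topologicalClosure_coe,
      polynomialFunctions.topologicalClosure]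
    rfl
  have heq : (fun f : C(I, ℝ) => ∫ u, f u * W u ∂ν₁) = fun f : C(I, ℝ) => ∫ u, f u * W u ∂ν₂ := by
    refine Continuous.ext_on hdense (hcont ν₁) (hcont ν₂) ?_
    rintro _ ⟨p, -, rfl⟩
    simp only
    induction p using Polynomial.induction_on' with
    | add p q hp hq =>
      simp only [map_add, ContinuousMap.add_apply, add_mul]
      rw [integral_add (hint ν₁ _) (hint ν₁ _), integral_add (hint ν₂ _) (hint ν₂ _)]
      exact congrArg₂ _ hp hq
    | monomial n c => simpa [mul_assoc, integral_const_mul] using Or.inl (h n)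
  exact congrFun heq ⟨g, hg⟩

theorem measure_ext_of_moments_eq {ν₁ ν₂ : Measure I} [IsFiniteMeasure ν₁] [IsFiniteMeasure ν₂]
    (h : ∀ k : ℕ, ∫ u : I, (u : ℝ) ^ k ∂ν₁ = ∫ u : I, (u : ℝ) ^ k ∂ν₂) : ν₁ = ν₂ :=
  ext_of_forall_integral_eq_of_IsFiniteMeasure fun f => by
    simpa using integral_mul_eq_of_moments_eq (W := fun _ => 1) continuous_const (by simpa using h)
      f.continuous

theorem continuousOn_integral_rpow (ν : Measure I) [IsFiniteMeasure ν] :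
    ContinuousOn (fun t : ℝ => ∫ u : I, (u : ℝ) ^ t ∂ν) (Ioi 0) := by
  refine continuousOn_of_dominated (bound := fun _ => 1) (fun t _ => ?_) (fun t ht => ?_)
    (integrable_const _) ?_
  · exact (measurable_subtype_coe.pow_const t).aestronglyMeasurable
  · refine .of_forall fun u => ?_
    rw [Real.norm_of_nonneg (Real.rpow_nonneg u.2.1 t)]
    exact Real.rpow_le_one u.2.1 u.2.2 (le_of_lt ht)
  · refine .of_forall fun u t ht => ?_
    exact (Real.continuousAt_const_rpow' (ne_of_gt ht)).continuousWithinAt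

theorem HasAlternatingDerivs.iterate_sub_comp_add_const {a : ℝ} (ha : 0 ≤ a) {φ : ℝ → ℝ}
    (h : HasAlternatingDerivs 0 φ) (m : ℕ) :
    HasAlternatingDerivs 0 ((fun (f : ℝ → ℝ) t => f t - f (t + a))^[m] φ) := by
  induction m with
  | zero => exact h
  | succ m ih =>
    rw [Function.iterate_succ_apply']
    exact (ih.mono (Nat.zero_le 1)).sub_comp_add_const ha

theorem seqDiff_iterate_comp (a : ℝ) (φ : ℝ → ℝ) (m k : ℕ) :
    seqDiff^[m] (fun k : ℕ => φ (k * a)) k =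
      (fun (f : ℝ → ℝ) t => f t - f (t + a))^[m] φ (k * a) := by
  induction m generalizing k with
  | zero => rfl
  | succ m ih =>
    rw [Function.iterate_succ_apply', Function.iterate_succ_apply', seqDiff, ih, ih]
    congr 2
    push_cast
    ring_nf

/-- **Bernstein's theorem** for completely monotone functions, in the variable `u = exp (-s)`. -/
theorem HasAlternatingDerivs.exists_measure {φ : ℝ → ℝ} (h : HasAlternatingDerivs 0 φ) :
    ∃ ν : Measure I, IsFiniteMeasure ν ∧ ∀ t : ℝ, 0 < t → φ t = ∫ u : I, (u : ℝ) ^ t ∂ν := by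
  have hex : ∀ a : ℝ, 0 ≤ a → ∃ ν : Measure I, IsFiniteMeasure ν ∧
      ∀ k : ℕ, φ (k * a) = ∫ u : I, (u : ℝ) ^ k ∂ν := fun a ha =>
    exists_measure_moment_eq fun m k => by
      rw [seqDiff_iterate_comp]
      exact (h.iterate_sub_comp_add_const ha m).nonneg (by positivity)
  obtain ⟨ν, hν, hνm⟩ := hex 1 zero_le_one
  refine ⟨ν, hν, ?_⟩
  have hrat : ∀ k N : ℕ, 0 < N → φ (k / N) = ∫ u : I, (u : ℝ) ^ ((k : ℝ) / N) ∂ν := by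
    intro k N hN
    have hN' : (N : ℝ) ≠ 0 := by positivity
    obtain ⟨ρ, hρ, hρm⟩ := hex (1 / N) (by positivity)
    -- The measure for mesh `1 / N`, pushed forward by `u ↦ u ^ N`, has the moments of `ν`. By
    -- uniqueness it is `ν`, so one measure represents `φ` at every positive rational.
    have hmap : ρ.map (fun u : I => u ^ N) = ν := by
      have hmeas : Measurable fun u : I => u ^ N := (continuous_pow N).measurable
      have : IsFiniteMeasure (ρ.map fun u : I => u ^ N) := inferInstance
      refine measure_ext_of_moments_eq fun j => ?_
      rw [← hνm, integral_map hmeas.aemeasurable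
        (by fun_prop : Continuous fun u : I => (u : ℝ) ^ j).aestronglyMeasurable]
      have := hρm (N * j)
      rw [show ((N * j : ℕ) : ℝ) * (1 / N) = j * 1 by push_cast; field_simp] at this
      rw [this]
      simp only [Set.Icc.coe_pow, pow_mul]
    have hmeas : Measurable fun u : I => u ^ N := (continuous_pow N).measurable
    rw [← hmap, integral_map hmeas.aemeasurable
      (measurable_subtype_coe.pow_const _).aestronglyMeasurable, div_eq_mul_one_div, hρm k]
    refine integral_congr_ae (.of_forall fun u => ?_)
    simp only [Set.Icc.coe_pow]
    rw [← Real.rpow_natCast, ← Real.rpow_natCast, ← Real.rpow_mul u.2.1]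
    congr 1
    field_simp
  have hd : Ioi (0 : ℝ) ⊆ closure (Ioi 0 ∩ range ((↑) : ℚ → ℝ)) :=
    Dense.open_subset_closure_inter Rat.isDenseEmbedding_coe_real.dense isOpen_Ioi
  have := EqOn.of_subset_closure (s := Ioi 0 ∩ range ((↑) : ℚ → ℝ)) (t := Ioi 0) (f := φ)
    (g := fun t => ∫ u : I, (u : ℝ) ^ t ∂ν) ?_ (h.continuousOn.mono Ioi_subset_Ici_self)
    (continuousOn_integral_rpow ν) inter_subset_left hd
  · exact fun t ht => this ht
  · rintro _ ⟨ht, q, rfl⟩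
    have hq : (0 : ℚ) ≤ q := by exact_mod_cast (le_of_lt ht : (0 : ℝ) ≤ q)
    have : (q : ℝ) = (q.num.toNat : ℝ) / q.den := by
      have h1 : ((q.num.toNat : ℤ) : ℝ) = q.num := by
        rw [Int.toNat_of_nonneg (Rat.num_nonneg.2 hq)]
      rw [← Int.cast_natCast (R := ℝ) q.num.toNat, h1]
      exact_mod_cast (Rat.num_div_den q).symm
    simp only
    rw [this]
    exact hrat _ _ q.den_pos

end Bernstein

/-! ### Gaussian integrals determine a measure -/

section Gaussian
open ProbabilityTheory
open scoped RealInnerProductSpace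

variable {E : Type*} [NormedAddCommGroup E] [InnerProductSpace ℝ E] [MeasurableSpace E]
  [BorelSpace E]

/-- The measure `exp (-s ‖x‖²) P`. -/
noncomputable def gaussianWeighted (s : ℝ) (P : Measure E) : Measure E :=
  P.withDensity fun x => ENNReal.ofReal (Real.exp (-s * ‖x‖ ^ 2))

omit [InnerProductSpace ℝ E] in
theorem measurable_gaussianWeight (s : ℝ) :
    Measurable fun x : E => ENNReal.ofReal (Real.exp (-s * ‖x‖ ^ 2)) := by fun_prop

omit [InnerProductSpace ℝ E] [BorelSpace E] in
theorem isFiniteMeasure_gaussianWeighted {s : ℝ} (hs : 0 < s) (P : Measure E) [IsFiniteMeasure P] :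
    IsFiniteMeasure (gaussianWeighted s P) := by
  refine ⟨?_⟩
  rw [gaussianWeighted, withDensity_apply _ MeasurableSet.univ, setLIntegral_univ]
  refine (lintegral_mono (g := fun _ => 1) fun x => ?_).trans_lt (by simp)
  rw [ENNReal.ofReal_le_one, Real.exp_le_one_iff]
  nlinarith [sq_nonneg ‖x‖]

omit [InnerProductSpace ℝ E] in
theorem gaussianWeighted_injective {s : ℝ} {P Q : Measure E}
    (h : gaussianWeighted s P = gaussianWeighted s Q) : P = Q := by
  have key : ∀ R : Measure E, (gaussianWeighted s R).withDensity
      (fun x : E => ENNReal.ofReal (Real.exp (-s * ‖x‖ ^ 2)))⁻¹ = R := fun R =>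
    withDensity_inv_same (measurable_gaussianWeight s) (.of_forall fun x => by
      simp [Real.exp_pos]) (.of_forall fun x => ENNReal.ofReal_ne_top)
  rw [← key P, h, key Q]

omit [MeasurableSpace E] [BorelSpace E] in
-- Completing the square: an exponential tilt of a centred Gaussian is a multiple of a shifted one.
theorem exp_mul_inner_mul_exp {s : ℝ} (hs : 0 < s) (x y : E) (t : ℝ) :
    Real.exp (-s * ‖x‖ ^ 2) * Real.exp (t * ⟪x, y⟫) =
      Real.exp (s * ‖(t / (2 * s)) • y‖ ^ 2) * Real.exp (-s * ‖x - (t / (2 * s)) • y‖ ^ 2) := by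
  rw [← Real.exp_add, ← Real.exp_add, norm_sub_sq_real, inner_smul_right]
  congr 1
  field_simp
  ring

omit [InnerProductSpace ℝ E] in
theorem integrable_gaussian {s : ℝ} (hs : 0 < s) (P : Measure E) [IsFiniteMeasure P] (y : E) :
    Integrable (fun x => Real.exp (-s * ‖x - y‖ ^ 2)) P := by
  have hc : Continuous fun x : E => Real.exp (-s * ‖x - y‖ ^ 2) := by fun_prop
  refine Integrable.of_bound hc.aestronglyMeasurable 1 (.of_forall ?_)
  intro x
  rw [Real.norm_of_nonneg (Real.exp_pos _).le, Real.exp_le_one_iff]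
  nlinarith [sq_nonneg ‖x - y‖]

theorem integrable_exp_inner_gaussianWeighted {s : ℝ} (hs : 0 < s) (P : Measure E)
    [IsFiniteMeasure P] (y : E) (t : ℝ) :
    Integrable (fun x => Real.exp (t * ⟪x, y⟫)) (gaussianWeighted s P) := by
  rw [gaussianWeighted, integrable_withDensity_iff_integrable_smul' (measurable_gaussianWeight s)
    (.of_forall fun x => ENNReal.ofReal_lt_top)]
  simp only [ENNReal.toReal_ofReal (Real.exp_pos _).le, smul_eq_mul, exp_mul_inner_mul_exp hs]
  exact (integrable_gaussian hs P _).const_mul _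

theorem mgf_inner_gaussianWeighted {s : ℝ} (hs : 0 < s) (P : Measure E) (y : E) (t : ℝ) :
    mgf (fun x => ⟪x, y⟫) (gaussianWeighted s P) t =
      Real.exp (s * ‖(t / (2 * s)) • y‖ ^ 2) *
        ∫ x, Real.exp (-s * ‖x - (t / (2 * s)) • y‖ ^ 2) ∂P := by
  rw [mgf, gaussianWeighted, integral_withDensity_eq_integral_toReal_smul
    (measurable_gaussianWeight s) (.of_forall fun x => ENNReal.ofReal_lt_top)]
  simp only [ENNReal.toReal_ofReal (Real.exp_pos _).le, smul_eq_mul, exp_mul_inner_mul_exp hs]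
  rw [integral_const_mul]

/-- After weighting by `exp (-s ‖x‖ ^ 2)`, Gaussian integrals become the moment generating functions
of all `⟪x, y⟫`. These are finite for every real `t`, so they continue analytically to `Complex.I`,
where they are characteristic functions. -/
theorem measure_ext_of_integral_gaussian_of_secondCountable [CompleteSpace E]
    [SecondCountableTopology E] {s : ℝ} (hs : 0 < s) {P Q : Measure E} [IsFiniteMeasure P]
    [IsFiniteMeasure Q] (h : ∀ y : E, ∫ x, Real.exp (-s * ‖x - y‖ ^ 2) ∂P =
      ∫ x, Real.exp (-s * ‖x - y‖ ^ 2) ∂Q) : P = Q := by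
  have := isFiniteMeasure_gaussianWeighted hs P
  have := isFiniteMeasure_gaussianWeighted hs Q
  refine gaussianWeighted_injective (s := s) (Measure.ext_of_charFun (funext fun y => ?_))
  have hmgf : mgf (fun x => ⟪x, y⟫) (gaussianWeighted s P) =
      mgf (fun x => ⟪x, y⟫) (gaussianWeighted s Q) := funext fun t => by
    rw [mgf_inner_gaussianWeighted hs, mgf_inner_gaussianWeighted hs, h]
  have hzero : gaussianWeighted s P = 0 ↔ gaussianWeighted s Q = 0 := by
    have := congrFun hmgf 0
    simp only [mgf_zero'] at this
    rw [← Measure.measure_univ_eq_zero, ← measureReal_eq_zero_iff, this, measureReal_eq_zero_iff,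
      Measure.measure_univ_eq_zero]
  have hc := eqOn_complexMGF_of_mgf' hmgf hzero (x := Complex.I) (by
    have : integrableExpSet (fun x => ⟪x, y⟫) (gaussianWeighted s P) = univ :=
      eq_univ_of_forall fun t => integrable_exp_inner_gaussianWeighted hs P y t
    simp [this])
  simpa only [complexMGF, charFun, mul_comm Complex.I] using hc

theorem measure_ext_of_integral_gaussian [CompleteSpace E] {s : ℝ} (hs : 0 < s) {P Q : Measure E}
    [IsFiniteMeasure P] [IsFiniteMeasure Q] {S : Set E} (hS : TopologicalSpace.IsSeparable S)
    (hP : P Sᶜ = 0) (hQ : Q Sᶜ = 0) (h : ∀ y : E, ∫ x, Real.exp (-s * ‖x - y‖ ^ 2) ∂P =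
      ∫ x, Real.exp (-s * ‖x - y‖ ^ 2) ∂Q) : P = Q := by
  -- Both measures live on the closed span of `S`, a separable Hilbert space, which reduces the
  -- claim to the second countable case.
  set V : Submodule ℝ E := (Submodule.span ℝ S).topologicalClosure with hV
  have hSV : S ⊆ V := Submodule.subset_span.trans (Submodule.le_topologicalClosure _)
  have hVs : TopologicalSpace.IsSeparable (V : Set E) := by
    rw [hV, Submodule.topologicalClosure_coe]
    exact (hS.span (R := ℝ)).closure
  have hVc : IsClosed (V : Set E) := Submodule.isClosed_topologicalClosure _
  have : CompleteSpace V := hVc.completeSpace_coe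
  have : TopologicalSpace.SeparableSpace V := hVs.separableSpace
  have : SecondCountableTopology V := UniformSpace.secondCountable_of_separable V
  have hemb : MeasurableEmbedding ((↑) : V → E) := MeasurableEmbedding.subtype_coe hVc.measurableSet
  have hmap : ∀ R : Measure E, R Sᶜ = 0 → (R.comap ((↑) : V → E)).map (↑) = R := fun R hR => by
    rw [hemb.map_comap, Subtype.range_coe, Measure.restrict_eq_self_of_ae_mem]
    exact measure_mono_null (compl_subset_compl.2 hSV) hR
  have hfin : ∀ R : Measure E, IsFiniteMeasure R → IsFiniteMeasure (R.comap ((↑) : V → E)) :=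
    fun R _ => ⟨by rw [hemb.comap_apply]; exact measure_lt_top R _⟩
  have := hfin P ‹_›
  have := hfin Q ‹_›
  have key : P.comap ((↑) : V → E) = Q.comap ((↑) : V → E) := by
    refine measure_ext_of_integral_gaussian_of_secondCountable hs fun y => ?_
    have := h y
    rw [← hmap P hP, ← hmap Q hQ, hemb.integral_map, hemb.integral_map] at this
    simpa using this
  rw [← hmap P hP, key, hmap Q hQ]

end Gaussian

/-! ### Growth and integrability -/

section Growth
variable {E : Type*} [NormedAddCommGroup E]

/-- Leaving `K` free gives a single dominating function for all `y` in a ball. -/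
theorem abs_comp_norm_sub_sq_le {ψ : ℝ → ℝ} {ℓ : ℕ} {C : ℝ} (hC0 : 0 ≤ C)
    (hC : ∀ t, 0 ≤ t → |ψ t| ≤ C * (1 + t) ^ ℓ) {x y : E} {c K : ℝ} (hc : 0 ≤ c)
    (hK : 1 + c + 2 * ‖y‖ ^ 2 ≤ K) :
    |ψ (‖x - y‖ ^ 2 + c)| ≤ C * 2 ^ (ℓ - 1) * (2 ^ ℓ * ‖x‖ ^ (2 * ℓ) + K ^ ℓ) := by
  have hK0 : 0 ≤ K := le_trans (by positivity) hK
  have h1 : 1 + (‖x - y‖ ^ 2 + c) ≤ 2 * ‖x‖ ^ 2 + K := by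
    have := norm_sub_le x y
    have := pow_le_pow_left₀ (norm_nonneg _) this 2
    nlinarith [sq_nonneg (‖x‖ - ‖y‖)]
  calc |ψ (‖x - y‖ ^ 2 + c)| ≤ C * (1 + (‖x - y‖ ^ 2 + c)) ^ ℓ := hC _ (by positivity)
    _ ≤ C * (2 * ‖x‖ ^ 2 + K) ^ ℓ := by gcongr
    _ ≤ C * (2 ^ (ℓ - 1) * ((2 * ‖x‖ ^ 2) ^ ℓ + K ^ ℓ)) := by
      gcongr
      exact add_pow_le (by positivity) hK0 ℓ
    _ = _ := by rw [mul_pow, ← pow_mul, mul_assoc]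

theorem ContinuousOn.continuous_comp_norm_sub_sq {ψ : ℝ → ℝ} (h : ContinuousOn ψ (Ici 0)) (y : E)
    {c : ℝ} (hc : 0 ≤ c) : Continuous fun x : E => ψ (‖x - y‖ ^ 2 + c) :=
  h.comp_continuous (by fun_prop) fun x => by simp only [mem_Ici]; positivity

variable [MeasurableSpace E] [BorelSpace E]

theorem integrable_comp_norm_sub_sq {ψ : ℝ → ℝ} {ℓ : ℕ} {C : ℝ} (hC0 : 0 ≤ C)
    (hψ : ContinuousOn ψ (Ici 0)) (hC : ∀ t, 0 ≤ t → |ψ t| ≤ C * (1 + t) ^ ℓ) {R : Measure E}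
    [IsFiniteMeasure R] (hR : Integrable (fun x : E => ‖x‖ ^ (2 * ℓ)) R) (y : E) {c : ℝ}
    (hc : 0 ≤ c) : Integrable (fun x => ψ (‖x - y‖ ^ 2 + c)) R :=
  (((hR.const_mul (2 ^ ℓ)).add (integrable_const _)).const_mul _).mono'
    (hψ.continuous_comp_norm_sub_sq y hc).aestronglyMeasurable
    (.of_forall fun _ => abs_comp_norm_sub_sq_le hC0 hC hc le_rfl)

theorem integrable_norm_pow_of_le {R : Measure E} [IsFiniteMeasure R] {k m : ℕ} (hkm : k ≤ m)
    (h : Integrable (fun x : E => ‖x‖ ^ m) R) : Integrable (fun x : E => ‖x‖ ^ k) R := by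
  refine ((integrable_const (1 : ℝ)).add h).mono'
    (by fun_prop : Continuous fun x : E => ‖x‖ ^ k).aestronglyMeasurable (.of_forall fun x => ?_)
  rw [Real.norm_of_nonneg (by positivity)]
  show ‖x‖ ^ k ≤ 1 + ‖x‖ ^ m
  rcases le_total ‖x‖ 1 with h1 | h1
  · have := pow_le_one₀ (norm_nonneg x) h1 (n := k)
    have : 0 ≤ ‖x‖ ^ m := by positivity
    linarith
  · have := pow_le_pow_right₀ h1 hkm
    linarith

end Growth

namespace HasAlternatingDerivs

theorem integrable_comp {E : Type*} [NormedAddCommGroup E] [MeasurableSpace E] [BorelSpace E]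
    {ψ : ℝ → ℝ} {ℓ : ℕ} (h : HasAlternatingDerivs ℓ ψ) {R : Measure E} [IsFiniteMeasure R]
    (hR : Integrable (fun x : E => ‖x‖ ^ (2 * ℓ)) R) (y : E) {c : ℝ} (hc : 0 ≤ c) :
    Integrable (fun x => ψ (‖x - y‖ ^ 2 + c)) R := by
  obtain ⟨C, hC0, hC⟩ := h.exists_abs_le
  exact integrable_comp_norm_sub_sq hC0 h.continuousOn hC hR y hc

end HasAlternatingDerivs

/-! ### From equal integrals to a constant derivative -/

section Annihilation
open unitInterval

variable {E : Type*} [NormedAddCommGroup E] [MeasurableSpace E] [BorelSpace E]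

/-- The function `u ↦ ∫ u ^ (‖x - y‖ ^ 2 + 1) dP(x)` on the unit interval. -/
noncomputable def powerTransform (P : Measure E) (y : E) (u : I) : ℝ :=
  ∫ x, (u : ℝ) ^ (‖x - y‖ ^ 2 + 1) ∂P

theorem norm_rpow_le_one (u : I) {t : ℝ} (ht : 0 ≤ t) : ‖(u : ℝ) ^ t‖ ≤ 1 := by
  rw [Real.norm_of_nonneg (Real.rpow_nonneg u.2.1 t)]
  exact Real.rpow_le_one u.2.1 u.2.2 ht

theorem measurable_rpow_norm_sub_sq (y : E) (c : ℝ) :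
    Measurable fun p : E × I => (p.2 : ℝ) ^ (‖p.1 - y‖ ^ 2 + c) := by
  have h1 : Measurable fun x : E => ‖x - y‖ ^ 2 + c :=
    (by fun_prop : Continuous fun x : E => ‖x - y‖ ^ 2 + c).measurable
  exact (measurable_subtype_coe.comp measurable_snd).pow (h1.comp measurable_fst)

theorem integrable_rpow_norm_sub_sq (P : Measure E) [IsFiniteMeasure P] (y : E) (u : I) {c : ℝ}
    (hc : 0 ≤ c) : Integrable (fun x => (u : ℝ) ^ (‖x - y‖ ^ 2 + c)) P :=
  Integrable.of_bound ((measurable_rpow_norm_sub_sq y c).comp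
    (measurable_id.prodMk measurable_const)).aestronglyMeasurable 1
    (.of_forall fun _ => norm_rpow_le_one u (by positivity))

theorem continuous_powerTransform (P : Measure E) [IsFiniteMeasure P] (y : E) :
    Continuous (powerTransform P y) := by
  refine continuous_of_dominated (bound := fun _ => 1)
    (fun u => (integrable_rpow_norm_sub_sq P y u zero_le_one).aestronglyMeasurable)
    (fun u => .of_forall fun x => norm_rpow_le_one u (by positivity)) (integrable_const _)
    (.of_forall fun x => ?_)
  exact continuous_subtype_val.rpow_const fun u => Or.inr (by positivity)

/-- Fubini. The `+ 1` keeps the exponent positive even at `x = y`, as the representation of `f` is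
available only for `t > 0`. -/
theorem integral_pow_mul_powerTransform {f : ℝ → ℝ} {ν : Measure I} [IsFiniteMeasure ν]
    (hf : ∀ t : ℝ, 0 < t → f t = ∫ u : I, (u : ℝ) ^ t ∂ν) (P : Measure E) [IsFiniteMeasure P]
    (y : E) (k : ℕ) :
    ∫ u : I, (u : ℝ) ^ k * powerTransform P y u ∂ν = ∫ x, f (‖x - y‖ ^ 2 + (k + 1)) ∂P := by
  have h1 : ∀ u : I, (u : ℝ) ^ k * powerTransform P y u =
      ∫ x, (u : ℝ) ^ (‖x - y‖ ^ 2 + (k + 1)) ∂P := fun u => by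
    rw [powerTransform, ← integral_const_mul]
    refine integral_congr_ae (.of_forall fun x => ?_)
    simp only
    rw [← Real.rpow_natCast, ← Real.rpow_add_of_nonneg u.2.1 (by positivity) (by positivity)]
    congr 1
    ring
  have h2 : ∀ x : E, f (‖x - y‖ ^ 2 + (k + 1)) = ∫ u : I, (u : ℝ) ^ (‖x - y‖ ^ 2 + (k + 1)) ∂ν :=
    fun x => hf _ (by positivity)
  simp only [h1, h2]
  refine (integral_integral_swap ?_).symm
  exact Integrable.of_bound (measurable_rpow_norm_sub_sq y _).aestronglyMeasurable 1
    (.of_forall fun p => norm_rpow_le_one p.2 (by positivity))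

theorem restrict_eq_of_integral_mul_eq {ν₁ ν₂ : Measure I} [IsFiniteMeasure ν₁] [IsFiniteMeasure ν₂]
    {W : I → ℝ} (hW : Continuous W)
    (h : ∀ g : I → ℝ, Continuous g → ∫ u, g u * W u ∂ν₁ = ∫ u, g u * W u ∂ν₂) :
    ν₁.restrict {u | W u ≠ 0} = ν₂.restrict {u | W u ≠ 0} := by
  -- Testing against `W * g` replaces the signed weight `W` by `W ^ 2`, so genuine measures are
  -- compared; the weight can then be divided out where `W ≠ 0`.
  set w : I → ENNReal := fun u => ENNReal.ofReal (W u ^ 2) with hw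
  have hwm : Measurable w := by fun_prop
  have hO : MeasurableSet {u | W u ≠ 0} := (isOpen_ne_fun hW continuous_const).measurableSet
  have hfin : ∀ ν : Measure I, IsFiniteMeasure ν → IsFiniteMeasure (ν.withDensity w) := fun ν _ =>
    isFiniteMeasure_withDensity_ofReal
      ((hW.pow 2).integrable_of_hasCompactSupport (HasCompactSupport.of_compactSpace _)).2
  have := hfin ν₁ ‹_›
  have := hfin ν₂ ‹_›
  have key : ν₁.withDensity w = ν₂.withDensity w := by
    refine ext_of_forall_integral_eq_of_IsFiniteMeasure fun g => ?_
    have h1 := h (fun u => W u * g u) (hW.mul g.continuous)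
    rw [integral_withDensity_eq_integral_toReal_smul hwm (.of_forall fun _ => ENNReal.ofReal_lt_top),
      integral_withDensity_eq_integral_toReal_smul hwm (.of_forall fun _ => ENNReal.ofReal_lt_top)]
    simp only [hw, ENNReal.toReal_ofReal (sq_nonneg _), smul_eq_mul]
    have e : ∀ u, W u ^ 2 * g u = W u * g u * W u := fun u => by ring
    simpa only [e] using h1
  have hinv : ∀ ν : Measure I, ((ν.withDensity w).restrict {u | W u ≠ 0}).withDensity w⁻¹ =
      ν.restrict {u | W u ≠ 0} := fun ν => by
    rw [restrict_withDensity hO]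
    refine withDensity_inv_same hwm ?_ (.of_forall fun _ => ENNReal.ofReal_ne_top)
    filter_upwards [ae_restrict_mem hO] with u hu
    have : 0 < W u ^ 2 := by
      have : W u ≠ 0 := hu
      positivity
    simp only [hw, ne_eq, ENNReal.ofReal_eq_zero, not_le]
    exact this
  rw [← hinv ν₁, key, hinv ν₂]

theorem exists_eq_const_of_measure_eq_on_Ioo {f₁ f₂ : ℝ → ℝ} {ν₁ ν₂ : Measure I}
    [IsFiniteMeasure ν₁] [IsFiniteMeasure ν₂]
    (hf₁ : ∀ t : ℝ, 0 < t → f₁ t = ∫ u : I, (u : ℝ) ^ t ∂ν₁)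
    (hf₂ : ∀ t : ℝ, 0 < t → f₂ t = ∫ u : I, (u : ℝ) ^ t ∂ν₂) {U : Set I} (hU : MeasurableSet U)
    (hUI : ∀ u : I, 0 < (u : ℝ) → (u : ℝ) < 1 → u ∈ U) (h : ν₁.restrict U = ν₂.restrict U) :
    ∃ a, ∀ t, 0 < t → f₁ t - f₂ t = a := by
  -- Outside `U` only `u = 0` and `u = 1` can occur, and there `u ^ t = u` for every `t > 0`.
  refine ⟨∫ u in Uᶜ, (u : ℝ) ∂ν₁ - ∫ u in Uᶜ, (u : ℝ) ∂ν₂, fun t ht => ?_⟩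
  have hint : ∀ ν : Measure I, IsFiniteMeasure ν → Integrable (fun u : I => (u : ℝ) ^ t) ν :=
    fun ν _ => Integrable.of_bound (measurable_subtype_coe.pow_const t).aestronglyMeasurable 1
      (.of_forall fun u => norm_rpow_le_one u ht.le)
  have hc : ∀ ν : Measure I, ∫ u in Uᶜ, (u : ℝ) ^ t ∂ν = ∫ u in Uᶜ, (u : ℝ) ∂ν := fun ν => by
    refine setIntegral_congr_fun hU.compl fun u hu => ?_
    rcases u.2.1.eq_or_lt with h0 | h0
    · simp [← h0, ht.ne']
    · rcases u.2.2.eq_or_lt with h1 | h1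
      · simp [h1]
      · exact absurd (hUI u h0 h1) hu
  rw [hf₁ t ht, hf₂ t ht, ← integral_add_compl hU (hint ν₁ ‹_›),
    ← integral_add_compl hU (hint ν₂ ‹_›), h, hc, hc]
  ring

variable [InnerProductSpace ℝ E] [CompleteSpace E]

/-- With `s = -log u > 0`, the kernel is `u` times `exp (-s ‖x - y‖ ^ 2)`. -/
theorem exists_powerTransform_ne {P Q : Measure E} [IsFiniteMeasure P] [IsFiniteMeasure Q]
    {S : Set E} (hS : TopologicalSpace.IsSeparable S) (hP : P Sᶜ = 0) (hQ : Q Sᶜ = 0)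
    (hPQ : P ≠ Q) {u : I} (hu0 : 0 < (u : ℝ)) (hu1 : (u : ℝ) < 1) :
    ∃ y, powerTransform P y u - powerTransform Q y u ≠ 0 := by
  by_contra! hcon
  refine hPQ (measure_ext_of_integral_gaussian (s := -Real.log u)
    (neg_pos.2 (Real.log_neg hu0 hu1)) hS hP hQ fun y => ?_)
  have key : ∀ ρ : Measure E, powerTransform ρ y u =
      (u : ℝ) * ∫ x, Real.exp (-(-Real.log (u : ℝ)) * ‖x - y‖ ^ 2) ∂ρ := fun ρ => by
    rw [powerTransform, ← integral_const_mul]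
    refine integral_congr_ae (.of_forall fun x => ?_)
    simp only [neg_neg]
    rw [Real.rpow_add_one hu0.ne', Real.rpow_def_of_pos hu0, mul_comm]
  have := hcon y
  rw [key, key, ← mul_sub, mul_eq_zero, or_iff_right hu0.ne', sub_eq_zero] at this
  exact this

theorem exists_eq_const_of_annihilated {P Q : Measure E} [IsFiniteMeasure P] [IsFiniteMeasure Q]
    {S : Set E} (hS : TopologicalSpace.IsSeparable S) (hP : P Sᶜ = 0) (hQ : Q Sᶜ = 0)
    (hPQ : P ≠ Q) {f₁ f₂ : ℝ → ℝ} (h₁ : HasAlternatingDerivs 0 f₁) (h₂ : HasAlternatingDerivs 0 f₂)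
    (h : ∀ y : E, ∀ c : ℝ, 0 ≤ c → ∫ x, (f₁ (‖x - y‖ ^ 2 + c) - f₂ (‖x - y‖ ^ 2 + c)) ∂P =
      ∫ x, (f₁ (‖x - y‖ ^ 2 + c) - f₂ (‖x - y‖ ^ 2 + c)) ∂Q) :
    ∃ a, ∀ t, 0 < t → f₁ t - f₂ t = a := by
  obtain ⟨ν₁, _, hν₁⟩ := h₁.exists_measure
  obtain ⟨ν₂, _, hν₂⟩ := h₂.exists_measure
  set W : E → I → ℝ := fun y u => powerTransform P y u - powerTransform Q y u with hW
  have hWc : ∀ y, Continuous (W y) := fun y =>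
    (continuous_powerTransform P y).sub (continuous_powerTransform Q y)
  have hres : ∀ y, ν₁.restrict {u | W y u ≠ 0} = ν₂.restrict {u | W y u ≠ 0} := by
    intro y
    refine restrict_eq_of_integral_mul_eq (hWc y) fun g hg =>
      integral_mul_eq_of_moments_eq (hWc y) (fun k => ?_) hg
    have hi : ∀ (f : ℝ → ℝ), HasAlternatingDerivs 0 f → ∀ (R : Measure E), IsFiniteMeasure R →
        Integrable (fun x => f (‖x - y‖ ^ 2 + (k + 1))) R := fun f hf R _ =>
      hf.integrable_comp (by simp) y (by positivity)
    have hj : ∀ (ν : Measure I), IsFiniteMeasure ν → ∀ (R : Measure E), IsFiniteMeasure R →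
        Integrable (fun u : I => (u : ℝ) ^ k * powerTransform R y u) ν := fun ν _ R _ =>
      ((continuous_subtype_val.pow k).mul
        (continuous_powerTransform R y)).integrable_of_hasCompactSupport
          (HasCompactSupport.of_compactSpace _)
    have hyk := h y (k + 1) (by positivity)
    rw [integral_sub (hi f₁ h₁ P ‹_›) (hi f₂ h₂ P ‹_›),
      integral_sub (hi f₁ h₁ Q ‹_›) (hi f₂ h₂ Q ‹_›),
      ← integral_pow_mul_powerTransform hν₁, ← integral_pow_mul_powerTransform hν₁,
      ← integral_pow_mul_powerTransform hν₂, ← integral_pow_mul_powerTransform hν₂] at hyk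
    simp only [hW, mul_sub]
    rw [integral_sub (hj ν₁ ‹_› P ‹_›) (hj ν₁ ‹_› Q ‹_›),
      integral_sub (hj ν₂ ‹_› P ‹_›) (hj ν₂ ‹_› Q ‹_›)]
    linarith
  -- Lindelöf: countably many of the open sets `{W y ≠ 0}` have the same union, so equality of the
  -- measures on each passes to the union.
  obtain ⟨T, hTc, hT⟩ := TopologicalSpace.isOpen_iUnion_countable (fun y => {u | W y u ≠ 0})
    fun y => isOpen_ne_fun (hWc y) continuous_const
  have hopen : IsOpen (⋃ y ∈ T, {u | W y u ≠ 0}) :=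
    isOpen_biUnion fun y _ => isOpen_ne_fun (hWc y) continuous_const
  refine exists_eq_const_of_measure_eq_on_Ioo hν₁ hν₂ hopen.measurableSet (fun u hu0 hu1 => ?_)
    ((Measure.restrict_biUnion_congr hTc).2 fun y _ => hres y)
  rw [hT]
  exact mem_iUnion.2 (exists_powerTransform_ne hS hP hQ hPQ hu0 hu1)

theorem iteratedDeriv_const_of_annihilated {P Q : Measure E} [IsFiniteMeasure P] [IsFiniteMeasure Q]
    {S : Set E} (hS : TopologicalSpace.IsSeparable S) (hP : P Sᶜ = 0) (hQ : Q Sᶜ = 0)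
    (hPQ : P ≠ Q) {ℓ : ℕ} : ∀ {f₁ f₂ : ℝ → ℝ}, HasAlternatingDerivs ℓ f₁ →
    HasAlternatingDerivs ℓ f₂ → Integrable (fun x : E => ‖x‖ ^ (2 * ℓ)) P →
    Integrable (fun x : E => ‖x‖ ^ (2 * ℓ)) Q →
    (∀ y : E, ∀ c : ℝ, 0 ≤ c → ∫ x, (f₁ (‖x - y‖ ^ 2 + c) - f₂ (‖x - y‖ ^ 2 + c)) ∂P =
      ∫ x, (f₁ (‖x - y‖ ^ 2 + c) - f₂ (‖x - y‖ ^ 2 + c)) ∂Q) →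
    ∃ a, ∀ t, 0 < t → iteratedDeriv ℓ (fun t => f₁ t - f₂ t) t = a := by
  induction ℓ with
  | zero =>
    intro f₁ f₂ h₁ h₂ _ _ h
    simpa using exists_eq_const_of_annihilated hS hP hQ hPQ h₁ h₂ h
  | succ ℓ ih =>
    intro f₁ f₂ h₁ h₂ hPm hQm h
    set ψ : ℝ → ℝ := fun t => f₁ t - f₂ t with hψ
    have hs : ContDiffOn ℝ ∞ ψ (Ioi 0) := h₁.contDiffOn.sub h₂.contDiffOn
    have hi : ∀ (R : Measure E), IsFiniteMeasure R →
        Integrable (fun x : E => ‖x‖ ^ (2 * (ℓ + 1))) R → ∀ (y : E) (c : ℝ), 0 ≤ c →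
        Integrable (fun x => ψ (‖x - y‖ ^ 2 + c)) R := fun R _ hR y c hc =>
      (h₁.integrable_comp hR y hc).sub (h₂.integrable_comp hR y hc)
    -- The difference with step `a` is again annihilated, using the shifts `c` and `c + a`. By
    -- induction its `ℓ`-th derivative is constant, so the next derivative of `ψ` is unchanged by
    -- the shift `a`.
    have hstep : ∀ a, 0 < a → ∀ t, 0 < t →
        iteratedDeriv (ℓ + 1) ψ t = iteratedDeriv (ℓ + 1) ψ (t + a) := by
      intro a ha t ht
      obtain ⟨b, hb⟩ := ih (h₁.sub_comp_add_const ha.le) (h₂.sub_comp_add_const ha.le)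
        (integrable_norm_pow_of_le (by omega) hPm) (integrable_norm_pow_of_le (by omega) hQm) (by
          intro y c hc
          have e : ∀ x : E, f₁ (‖x - y‖ ^ 2 + c) - f₁ (‖x - y‖ ^ 2 + c + a) -
              (f₂ (‖x - y‖ ^ 2 + c) - f₂ (‖x - y‖ ^ 2 + c + a)) =
              ψ (‖x - y‖ ^ 2 + c) - ψ (‖x - y‖ ^ 2 + (c + a)) := fun x => by
            simp only [hψ, add_assoc]; ring
          have hca : 0 ≤ c + a := by positivity
          simp only [e]
          rw [integral_sub (hi P ‹_› hPm y c hc) (hi P ‹_› hPm y _ hca),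
            integral_sub (hi Q ‹_› hQm y c hc) (hi Q ‹_› hQm y _ hca)]
          exact congrArg₂ _ (h y c hc) (h y _ hca))
      have hb' : ∀ t, 0 < t → iteratedDeriv ℓ (fun t => ψ t - ψ (t + a)) t = b := fun t ht => by
        rw [← hb t ht]
        congr 1
        funext t
        simp only [hψ]
        ring
      have h0 : iteratedDeriv (ℓ + 1) (fun t => ψ t - ψ (t + a)) t = 0 := by
        have : iteratedDeriv ℓ (fun t => ψ t - ψ (t + a)) =ᶠ[nhds t] fun _ => b := by
          filter_upwards [isOpen_Ioi.mem_nhds ht] with s hs using hb' s hs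
        rw [iteratedDeriv_succ, this.deriv_eq, deriv_const]
      rw [iteratedDeriv_sub_comp_add_const hs ha.le ht] at h0
      linarith
    refine ⟨iteratedDeriv (ℓ + 1) ψ 1, fun t ht => ?_⟩
    -- Shifting `t` by 1 and 1 by `t` reaches the same point.
    have e1 := hstep 1 one_pos t ht
    have e2 := hstep t ht 1 one_pos
    rw [e1, e2, add_comm t 1]

end Annihilation

/-! ### Separable carriers and Radon measures -/

section Regularity

theorem exists_isSeparable_measure_compl_eq_zero {X : Type*} [MetricSpace X]
    [MeasurableSpace X] [BorelSpace X] (m : Measure X) [IsFiniteMeasure m] [m.InnerRegular] :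
    ∃ S : Set X, TopologicalSpace.IsSeparable S ∧ m Sᶜ = 0 := by
  have h : ∀ n : ℕ, ∃ K : Set X, IsCompact K ∧ m Kᶜ < ((n : ENNReal) + 1)⁻¹ := fun n => by
    obtain ⟨K, -, hK, hlt⟩ := (MeasurableSet.univ (α := X)).exists_isCompact_sdiff_lt
      (measure_ne_top m univ) (ε := ((n : ENNReal) + 1)⁻¹) (by simp)
    exact ⟨K, hK, by rwa [compl_eq_univ_sdiff]⟩
  choose K hK hlt using h
  refine ⟨⋃ n, K n, .iUnion fun n => (hK n).isSeparable, ?_⟩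
  refine le_antisymm (ge_of_tendsto' ENNReal.tendsto_inv_nat_nhds_zero fun n => ?_) zero_le
  calc m (⋃ n, K n)ᶜ ≤ m (K n)ᶜ := measure_mono (compl_subset_compl.2 (subset_iUnion K n))
    _ ≤ ((n : ENNReal) + 1)⁻¹ := (hlt n).le
    _ ≤ (n : ENNReal)⁻¹ := ENNReal.inv_le_inv.2 le_self_add

theorem isRadonMeasure_of_finite_support {X : Type*} [MetricSpace X] [MeasurableSpace X]
    [BorelSpace X] {m : Measure X} [IsFiniteMeasure m] {F : Set X} (hF : F.Finite)
    (hm : m Fᶜ = 0) : IsRadonMeasure m where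
  finiteOnCompacts := inferInstance
  outerRegular := inferInstance
  innerRegular := ⟨fun s _ r hr => ⟨s ∩ F, inter_subset_left, (hF.inter_of_right s).isCompact, by
    rwa [measure_inter_conull hm]⟩⟩

end Regularity

/-! ### Real components of a vector measure -/

section Component

variable {X F : Type*} [MeasurableSpace X] [NormedAddCommGroup F] [NormedSpace ℝ F]

/-- The signed measure obtained by composing a vector measure with a real linear functional. -/
noncomputable def MeasureTheory.VectorMeasure.component (μ : VectorMeasure X F) (L : F →L[ℝ] ℝ) :
    SignedMeasure X :=
  μ.mapRange (L : F →+ ℝ) L.continuous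

theorem MeasureTheory.VectorMeasure.component_apply (μ : VectorMeasure X F) (L : F →L[ℝ] ℝ)
    (s : Set X) : μ.component L s = L (μ s) := rfl

theorem MeasureTheory.VectorMeasure.totalVariation_component_le (μ : VectorMeasure X F)
    (L : F →L[ℝ] ℝ) : (μ.component L).totalVariation ≤ ‖L‖₊ • μ.variation := by
  rw [SignedMeasure.totalVariation_eq_variation]
  refine VectorMeasure.variation_le_of_forall_enorm_le fun s _ => ?_
  rw [VectorMeasure.component_apply, Measure.smul_apply, Measure.nnreal_smul_coe_apply]
  grw [L.le_opENorm, VectorMeasure.enorm_measure_le_variation]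
  rfl

theorem MeasureTheory.VectorMeasure.posPart_component_le (μ : VectorMeasure X F)
    (L : F →L[ℝ] ℝ) :
    (μ.component L).toJordanDecomposition.posPart ≤ ‖L‖₊ • μ.variation :=
  le_trans (Measure.le_add_right le_rfl) (μ.totalVariation_component_le L)

theorem MeasureTheory.VectorMeasure.negPart_component_le (μ : VectorMeasure X F)
    (L : F →L[ℝ] ℝ) :
    (μ.component L).toJordanDecomposition.negPart ≤ ‖L‖₊ • μ.variation :=
  le_trans (Measure.le_add_left le_rfl) (μ.totalVariation_component_le L)

theorem MeasureTheory.VectorMeasure.integrable_posPart_component {μ : VectorMeasure X F}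
    (L : F →L[ℝ] ℝ) {f : X → ℝ} (hf : Integrable f μ.variation) :
    Integrable f (μ.component L).toJordanDecomposition.posPart :=
  (hf.smul_measure_nnreal (c := ‖L‖₊)).mono_measure (μ.posPart_component_le L)

theorem MeasureTheory.VectorMeasure.integrable_negPart_component {μ : VectorMeasure X F}
    (L : F →L[ℝ] ℝ) {f : X → ℝ} (hf : Integrable f μ.variation) :
    Integrable f (μ.component L).toJordanDecomposition.negPart :=
  (hf.smul_measure_nnreal (c := ‖L‖₊)).mono_measure (μ.negPart_component_le L)

omit [NormedAddCommGroup F] [NormedSpace ℝ F] in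
theorem continuous_L1_integral_of_le_smul {m m' : Measure X} {c : NNReal} (h : m' ≤ c • m) :
    Continuous fun f : X →₁[m] ℝ => ∫ x, f x ∂m' := by
  have hi : ∀ f : X →₁[m] ℝ, Integrable f m' := fun f =>
    ((L1.integrable_coeFn f).smul_measure_nnreal (c := c)).mono_measure h
  refine (LipschitzWith.of_dist_le_mul (K := c) fun f g => ?_).continuous
  have hfg : Integrable (fun x => ‖f x - g x‖) m :=
    ((L1.integrable_coeFn f).sub (L1.integrable_coeFn g)).norm
  rw [dist_eq_norm, ← integral_sub (hi f) (hi g)]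
  calc ‖∫ x, (f x - g x) ∂m'‖ ≤ ∫ x, ‖f x - g x‖ ∂m' := norm_integral_le_integral_norm _
    _ ≤ ∫ x, ‖f x - g x‖ ∂(c • m) := integral_mono_measure h
        (.of_forall fun _ => norm_nonneg _) (hfg.smul_measure_nnreal (c := c))
    _ = c * ∫ x, ‖f x - g x‖ ∂m := by rw [integral_smul_nnreal_measure]; rfl
    _ = c * dist f g := by
      rw [dist_eq_norm, L1.norm_eq_integral_norm]
      congr 1
      refine integral_congr_ae ?_
      filter_upwards [Lp.coeFn_sub f g] with x hx
      rw [hx, Pi.sub_apply]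

/-- Both sides are additive and continuous in `f` for the `L¹` norm of the variation, which
dominates both Jordan parts up to the factor `‖L‖₊`. It suffices to check indicators. -/
theorem apply_vectorMeasure_integral_eq_sub [CompleteSpace F] {μ : VectorMeasure X F}
    (L : F →L[ℝ] ℝ) {f : X → ℝ} (hf : Integrable f μ.variation) :
    L (∫ᵛ x, f x ∂•μ) = ∫ x, f x ∂(μ.component L).toJordanDecomposition.posPart -
      ∫ x, f x ∂(μ.component L).toJordanDecomposition.negPart := by
  have hac₁ : (μ.component L).toJordanDecomposition.posPart ≪ μ.variation :=
    Measure.absolutelyContinuous_of_le_smul (μ.posPart_component_le L)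
  have hac₂ : (μ.component L).toJordanDecomposition.negPart ≪ μ.variation :=
    Measure.absolutelyContinuous_of_le_smul (μ.negPart_component_le L)
  refine hf.induction (P := fun f => L (∫ᵛ x, f x ∂•μ) =
    ∫ x, f x ∂(μ.component L).toJordanDecomposition.posPart -
      ∫ x, f x ∂(μ.component L).toJordanDecomposition.negPart) ?_ ?_ ?_ ?_
  · intro c s hs hμ
    have h1 : ∫ᵛ x, s.indicator (fun _ => c) x ∂•μ = c • μ s := by
      rw [VectorMeasure.integral_eq_setToFun]
      exact setToFun_indicator_const _ hs hμ.ne c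
    rw [h1, map_smul, ← VectorMeasure.component_apply,
      SignedMeasure.apply_eq_posPart_real_sub_negPart_real _ hs, integral_indicator_const _ hs,
      integral_indicator_const _ hs]
    simp only [smul_eq_mul]
    ring
  · intro f g _ hf hg ihf ihg
    simp only [Pi.add_apply]
    rw [VectorMeasure.integral_fun_add hf hg, map_add, ihf, ihg,
      integral_add (μ.integrable_posPart_component L hf) (μ.integrable_posPart_component L hg),
      integral_add (μ.integrable_negPart_component L hf) (μ.integrable_negPart_component L hg)]
    ring
  · exact isClosed_eq (L.continuous.comp VectorMeasure.continuous_integral)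
      ((continuous_L1_integral_of_le_smul (μ.posPart_component_le L)).sub
        (continuous_L1_integral_of_le_smul (μ.negPart_component_le L)))
  · intro f g hfg _ ih
    rw [← VectorMeasure.integral_congr_ae hfg, ih, integral_congr_ae (hac₁.ae_eq hfg),
      integral_congr_ae (hac₂.ae_eq hfg)]

end Component

/-! ### Uniqueness for non-polynomial functions -/

section Injectivity

variable {E F : Type*} [NormedAddCommGroup E] [InnerProductSpace ℝ E] [CompleteSpace E]
  [MeasurableSpace E] [BorelSpace E] [NormedAddCommGroup F] [NormedSpace ℝ F] [CompleteSpace F]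

theorem eq_zero_of_annihilated {ℓ : ℕ} {f₁ f₂ : ℝ → ℝ} (h₁ : HasAlternatingDerivs ℓ f₁)
    (h₂ : HasAlternatingDerivs ℓ f₂) (hpoly : ¬ IsPolynomialOnNonneg fun t => f₁ t - f₂ t)
    (μ : VectorMeasure E F) [IsFiniteMeasure μ.variation] [μ.variation.InnerRegular]
    (hμ : Integrable (fun x : E => ‖x‖ ^ (2 * ℓ)) μ.variation)
    (h : ∀ y : E, ∀ c : ℝ, 0 ≤ c →
      ∫ᵛ x, (f₁ (‖x - y‖ ^ 2 + c) - f₂ (‖x - y‖ ^ 2 + c)) ∂•μ = 0) : μ = 0 := by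
  by_contra hne
  obtain ⟨s, hs, hμs⟩ : ∃ s, MeasurableSet s ∧ μ s ≠ 0 := by
    by_contra! hcon
    exact hne (VectorMeasure.ext fun s hs => hcon s hs)
  obtain ⟨L, hL⟩ := SeparatingDual.exists_ne_zero (R := ℝ) hμs
  obtain ⟨S, hS, hS0⟩ := exists_isSeparable_measure_compl_eq_zero μ.variation
  have hPQ : (μ.component L).toJordanDecomposition.posPart ≠
      (μ.component L).toJordanDecomposition.negPart := fun heq => by
    have := SignedMeasure.apply_eq_posPart_real_sub_negPart_real (μ.component L) hs
    rw [heq, sub_self, VectorMeasure.component_apply] at this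
    exact hL this
  obtain ⟨a, ha⟩ := iteratedDeriv_const_of_annihilated hS
    (Measure.absolutelyContinuous_of_le_smul (μ.posPart_component_le L) hS0)
    (Measure.absolutelyContinuous_of_le_smul (μ.negPart_component_le L) hS0) hPQ h₁ h₂
    (μ.integrable_posPart_component L hμ) (μ.integrable_negPart_component L hμ) (by
      intro y c hc
      have := apply_vectorMeasure_integral_eq_sub L
        ((h₁.integrable_comp hμ y hc).sub (h₂.integrable_comp hμ y hc))
      simp only [Pi.sub_apply] at this
      rw [h y c hc, map_zero] at this
      linarith)
  exact hpoly (isPolynomialOnNonneg_of_iteratedDeriv_const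
    (h₁.continuousOn.sub h₂.continuousOn) (h₁.contDiffOn.sub h₂.contDiffOn) ha)

end Injectivity

/-! ### Finitely supported measures annihilating polynomials -/

section FiniteSupport

variable {X F : Type*} [MetricSpace X] [MeasurableSpace X] [BorelSpace X] [NormedAddCommGroup F]

omit [MetricSpace X] [BorelSpace X] in
theorem variation_sum_dirac_le {ι : Type*} (s : Finset ι) (a : ι → X) (v : ι → F) :
    (∑ i ∈ s, VectorMeasure.dirac (a i) (v i)).variation ≤
      ∑ i ∈ s, ‖v i‖₊ • Measure.dirac (a i) := by
  refine (VectorMeasure.variation_finsetSum_le s _).trans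
    (Finset.sum_le_sum fun i _ => ?_)
  rw [VectorMeasure.variation_dirac]
  rfl

omit [MetricSpace X] [BorelSpace X] in
theorem isFiniteMeasure_variation_sum_dirac {ι : Type*} (s : Finset ι) (a : ι → X) (v : ι → F) :
    IsFiniteMeasure (∑ i ∈ s, VectorMeasure.dirac (a i) (v i)).variation := by
  have : IsFiniteMeasure (∑ i ∈ s, ‖v i‖₊ • Measure.dirac (a i)) := inferInstance
  exact isFiniteMeasure_of_le _ (variation_sum_dirac_le s a v)

theorem isBoundedRadon_sum_dirac {ι 𝕂 : Type*} [RCLike 𝕂] (s : Finset ι) (a : ι → X) (v : ι → 𝕂) :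
    IsBoundedRadon (∑ i ∈ s, VectorMeasure.dirac (a i) (v i)) := by
  have := isFiniteMeasure_variation_sum_dirac s a v
  refine ⟨this, isRadonMeasure_of_finite_support ((s.finite_toSet).image a) ?_⟩
  refine le_antisymm ((variation_sum_dirac_le s a v _).trans_eq ?_) zero_le
  have hm : MeasurableSet (a '' (s : Set ι))ᶜ := ((s.finite_toSet).image a).measurableSet.compl
  rw [Measure.finsetSum_apply]
  refine Finset.sum_eq_zero fun i hi => ?_
  rw [Measure.smul_apply, Measure.dirac_apply' _ hm, indicator_of_notMem, smul_zero]
  exact fun h => h (mem_image_of_mem a hi)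

theorem vectorMeasure_integrable_sum_dirac {ι : Type*} (s : Finset ι) (a : ι → X) (v : ι → F) (f : X → ℝ) :
    Integrable f (∑ i ∈ s, VectorMeasure.dirac (a i) (v i)).variation := by
  refine Integrable.mono_measure ?_ (variation_sum_dirac_le s a v)
  rw [integrable_finsetSum_measure]
  exact fun i _ => (integrable_dirac (by simp)).smul_measure_nnreal

theorem vectorMeasure_integral_sum_dirac [NormedSpace ℝ F] [CompleteSpace F] {ι : Type*} (s : Finset ι)
    (a : ι → X) (v : ι → F) (f : X → ℝ) :
    ∫ᵛ x, f x ∂•(∑ i ∈ s, VectorMeasure.dirac (a i) (v i)) = ∑ i ∈ s, f (a i) • v i := by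
  rw [VectorMeasure.integral_finsetSum_vectorMeasure]
  · simp
  · intro i _
    have := vectorMeasure_integrable_sum_dirac {i} a v f
    rwa [Finset.sum_singleton] at this

theorem sum_range_choose_mul_eval_eq_zero (q : Polynomial ℝ) {N : ℕ} (hN : q.natDegree < N) :
    ∑ k ∈ Finset.range (N + 1), ((-1 : ℝ) ^ (N - k) * N.choose k) * q.eval (k : ℝ) = 0 := by
  have h := congrFun (fwdDiff_iter_sum_mul_pow_eq_zero (n := N) q.coeff) 0
  rw [fwdDiff_iter_eq_sum_shift] at h
  simpa [← Polynomial.eval_eq_sum_range' hN, zsmul_eq_mul] using h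

theorem exists_ne_zero_annihilated {E 𝕂 : Type*} [RCLike 𝕂] [NormedAddCommGroup E]
    [InnerProductSpace ℝ E] [Nontrivial E] [MeasurableSpace E] [BorelSpace E] (p : Polynomial ℝ) :
    ∃ μ : VectorMeasure E 𝕂, μ ≠ 0 ∧ IsBoundedRadon μ ∧ (∀ f : E → ℝ, Integrable f μ.variation) ∧
      ∀ y : E, ∀ c : ℝ, ∫ᵛ x, p.eval (‖x - y‖ ^ 2 + c) ∂•μ = 0 := by
  obtain ⟨e, he⟩ := exists_ne (0 : E)
  -- At `x = k • e` the integrand is a polynomial in `k` of degree at most `2 * p.natDegree`, so a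
  -- difference of order one more kills it.
  set N := 2 * p.natDegree + 1 with hN
  set a : ℕ → E := fun k => (k : ℝ) • e
  set w : ℕ → ℝ := fun k => (-1) ^ (N - k) * N.choose k
  refine ⟨∑ k ∈ Finset.range (N + 1), VectorMeasure.dirac (a k) (w k : 𝕂), fun h0 => ?_,
    isBoundedRadon_sum_dirac _ _ _, vectorMeasure_integrable_sum_dirac _ _ _, fun y c => ?_⟩
  -- Since `e ≠ 0`, only `k = 0` charges the origin, with mass `(-1) ^ N`.
  · have h1 := congrArg (fun m : VectorMeasure E 𝕂 => m {0}) h0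
    simp only [FunLike.coe_sum, Finset.sum_apply, FunLike.coe_zero,
      Pi.zero_apply] at h1
    rw [Finset.sum_eq_single_of_mem 0 (by simp) fun k _ hk => ?_] at h1
    · rw [VectorMeasure.dirac_apply_of_mem (measurableSet_singleton 0) (by simp [a])] at h1
      simp [w] at h1
    · rw [VectorMeasure.dirac_apply_of_notMem]
      simp [a, he, hk]
  · rw [vectorMeasure_integral_sum_dirac]
    set q : Polynomial ℝ := p.comp (Polynomial.C (‖e‖ ^ 2) * Polynomial.X ^ 2 -
      Polynomial.C (2 * inner ℝ e y) * Polynomial.X + Polynomial.C (‖y‖ ^ 2 + c)) with hq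
    have hdeg : q.natDegree < N := by
      have h2 : (Polynomial.C (‖e‖ ^ 2) * Polynomial.X ^ 2 -
          Polynomial.C (2 * inner ℝ e y) * Polynomial.X +
            Polynomial.C (‖y‖ ^ 2 + c)).natDegree ≤ 2 := by compute_degree
      have := Nat.mul_le_mul_left p.natDegree h2
      rw [hq, Polynomial.natDegree_comp]
      omega
    have heval : ∀ k : ℕ, p.eval (‖a k - y‖ ^ 2 + c) = q.eval (k : ℝ) := fun k => by
      rw [hq, Polynomial.eval_comp]
      congr 1
      simp only [a, norm_sub_sq_real, norm_smul, inner_smul_left, Polynomial.eval_add,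
        Polynomial.eval_sub, Polynomial.eval_mul, Polynomial.eval_C, Polynomial.eval_pow,
        Polynomial.eval_X, mul_pow, Real.norm_natCast]
      simp
      ring
    have := sum_range_choose_mul_eval_eq_zero q hdeg
    have := congrArg (fun r : ℝ => (r : 𝕂)) this
    simp only [RCLike.ofReal_sum, RCLike.ofReal_zero] at this
    rw [← this]
    refine Finset.sum_congr rfl fun k _ => ?_
    rw [heval, RCLike.real_smul_eq_coe_mul, ← RCLike.ofReal_mul, mul_comm]

end FiniteSupport

/-! ### Shifts from orthonormal sequences -/

section InfiniteDimensional

open Filter Topology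

theorem exists_orthonormal_nat {𝕜 H : Type*} [RCLike 𝕜] [NormedAddCommGroup H]
    [InnerProductSpace 𝕜 H] [CompleteSpace H] (h : ¬ FiniteDimensional 𝕜 H) :
    ∃ v : ℕ → H, Orthonormal 𝕜 v := by
  obtain ⟨w, b, hb⟩ := exists_hilbertBasis 𝕜 H
  have hw : Infinite w := by
    by_contra hfin
    rw [not_infinite_iff_finite] at hfin
    have := Fintype.ofFinite w
    exact h b.toOrthonormalBasis.toBasis.finiteDimensional_of_finite
  exact ⟨fun n => b (Infinite.natEmbedding w n),
    b.orthonormal.comp _ (Infinite.natEmbedding w).injective⟩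

theorem Orthonormal.tendsto_norm_sub_sq {𝕜 H : Type*} [RCLike 𝕜] [NormedAddCommGroup H]
    [InnerProductSpace 𝕜 H] {v : ℕ → H} (hv : Orthonormal 𝕜 v) (z : H) {r : ℝ} :
    Tendsto (fun n => ‖z - (r : 𝕜) • v n‖ ^ 2) atTop (𝓝 (‖z‖ ^ 2 + r ^ 2)) := by
  have h0 : Tendsto (fun n => inner 𝕜 z (v n)) atTop (𝓝 0) := by
    rw [tendsto_zero_iff_norm_tendsto_zero]
    have h1 := (hv.inner_products_summable z).tendsto_atTop_zero
    have h2 := h1.sqrt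
    simp only [Real.sqrt_sq (norm_nonneg _), Real.sqrt_zero] at h2
    simpa only [norm_inner_symm] using h2
  have h1 : Tendsto (fun n => ‖z‖ ^ 2 - 2 * RCLike.re ((r : 𝕜) * inner 𝕜 z (v n)) + r ^ 2) atTop
      (𝓝 (‖z‖ ^ 2 - 2 * RCLike.re ((r : 𝕜) * 0) + r ^ 2)) :=
    (tendsto_const_nhds.sub (((RCLike.continuous_re.tendsto _).comp
      (h0.const_mul _)).const_mul _)).add tendsto_const_nhds
  simp only [mul_zero, map_zero, sub_zero] at h1
  refine h1.congr fun n => ?_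
  rw [@norm_sub_sq 𝕜, inner_smul_right, norm_smul, hv.1 n, mul_one, RCLike.norm_ofReal, sq_abs]

theorem integral_shift_eq_zero {𝕜 H F : Type*} [RCLike 𝕜] [NormedAddCommGroup H]
    [InnerProductSpace 𝕜 H] [CompleteSpace H] [MeasurableSpace H] [BorelSpace H]
    [NormedAddCommGroup F] [NormedSpace ℝ F] (hH : ¬ FiniteDimensional 𝕜 H) {ℓ : ℕ} {ψ : ℝ → ℝ}
    {C : ℝ} (hC0 : 0 ≤ C) (hψ : ContinuousOn ψ (Ici 0))
    (hC : ∀ t, 0 ≤ t → |ψ t| ≤ C * (1 + t) ^ ℓ) (μ : VectorMeasure H F)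
    [IsFiniteMeasure μ.variation] (hμ : Integrable (fun x : H => ‖x‖ ^ (2 * ℓ)) μ.variation)
    (h : ∀ y : H, ∫ᵛ x, ψ (‖x - y‖ ^ 2) ∂•μ = 0) (y : H) {c : ℝ} (hc : 0 ≤ c) :
    ∫ᵛ x, ψ (‖x - y‖ ^ 2 + c) ∂•μ = 0 := by
  obtain ⟨v, hv⟩ := exists_orthonormal_nat hH
  -- The points `z n` stay in a fixed ball, and `‖x - z n‖ ^ 2` tends to `‖x - y‖ ^ 2 + c` for each
  -- `x`.
  set z : ℕ → H := fun n => y + ((√c : ℝ) : 𝕜) • v n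
  have hz : ∀ n, ‖z n‖ ≤ ‖y‖ + √c := fun n => by
    refine (norm_add_le _ _).trans_eq ?_
    rw [norm_smul, hv.1 n, mul_one, RCLike.norm_ofReal, abs_of_nonneg (Real.sqrt_nonneg c)]
  set K : ℝ := 1 + 0 + 2 * (‖y‖ + √c) ^ 2
  have hlim : Tendsto (fun n => ∫ᵛ x, ψ (‖x - z n‖ ^ 2 + 0) ∂•μ) atTop
      (𝓝 (∫ᵛ x, ψ (‖x - y‖ ^ 2 + c) ∂•μ)) :=
    VectorMeasure.tendsto_integral_of_dominated_convergence
    (fun x => C * 2 ^ (ℓ - 1) * (2 ^ ℓ * ‖x‖ ^ (2 * ℓ) + K ^ ℓ))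
    (fun n => (hψ.continuous_comp_norm_sub_sq (z n) le_rfl).aestronglyMeasurable)
    (((hμ.const_mul (2 ^ ℓ)).add (integrable_const _)).const_mul _)
    (fun n => .of_forall fun x => abs_comp_norm_sub_sq_le hC0 hC le_rfl (by
      simp only [K]
      gcongr
      exact hz n))
    (.of_forall fun x => by
      have h1 := hv.tendsto_norm_sub_sq (x - y) (r := √c)
      rw [Real.sq_sqrt hc] at h1
      have h2 : ContinuousWithinAt ψ (Ici 0) (‖x - y‖ ^ 2 + c) :=
        hψ _ (by simp only [mem_Ici]; positivity)
      refine (h2.tendsto.comp (tendsto_nhdsWithin_iff.2 ⟨h1, .of_forall fun n => ?_⟩)).congr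
        fun n => ?_
      · simp only [mem_Ici]; positivity
      · simp only [Function.comp, z, add_zero, sub_sub])
  simp only [add_zero, h] at hlim
  exact (tendsto_nhds_unique hlim tendsto_const_nhds)

end InfiniteDimensional

theorem theorem5p1 {𝕜 𝕂 H : Type*} [RCLike 𝕜] [RCLike 𝕂]
    [NormedAddCommGroup H] [InnerProductSpace 𝕜 H] [CompleteSpace H] [Nontrivial H]
    [MeasurableSpace H] [BorelSpace H]
    (ℓ : ℕ) (φ ϕ ψ : ℝ → ℝ) (hφ : IsCM ℓ φ) (hϕ : IsCM ℓ ϕ) (hψ : ψ = fun t => φ t - ϕ t) :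
    (¬ FiniteDimensional 𝕜 H →
      ∀ μ : VectorMeasure H 𝕂, IsBoundedRadon μ →
        Integrable (fun x : H => ‖x‖ ^ (2 * ℓ)) μ.variation →
        (∀ y : H, ∫ᵛ x, ψ (‖x - y‖ ^ 2) ∂•μ = 0) →
        ∀ y : H, ∀ c : ℝ, 0 ≤ c → ∫ᵛ x, ψ (‖x - y‖ ^ 2 + c) ∂•μ = 0) ∧
    (¬ IsPolynomialOnNonneg ψ ↔
      ∀ μ : VectorMeasure H 𝕂, IsBoundedRadon μ →
        Integrable (fun x : H => ‖x‖ ^ (2 * ℓ)) μ.variation →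
        (∀ y : H, ∀ c : ℝ, 0 ≤ c → ∫ᵛ x, ψ (‖x - y‖ ^ 2 + c) ∂•μ = 0) →
        μ = 0) := by
  have h₁ := hφ.hasAlternatingDerivs
  have h₂ := hϕ.hasAlternatingDerivs
  refine ⟨fun hH μ hμ hint h y c hc => ?_, fun hpoly μ hμ hint h => ?_, fun h hpoly => ?_⟩
  · have := hμ.boundedVariation
    obtain ⟨C₁, hC₁0, hC₁⟩ := h₁.exists_abs_le
    obtain ⟨C₂, hC₂0, hC₂⟩ := h₂.exists_abs_le
    refine integral_shift_eq_zero hH (add_nonneg hC₁0 hC₂0)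
      (by rw [hψ]; exact h₁.continuousOn.sub h₂.continuousOn) (fun t ht => ?_) μ hint h y hc
    rw [hψ, add_mul]
    exact (abs_sub _ _).trans (add_le_add (hC₁ t ht) (hC₂ t ht))
  -- Only norms enter the statement, so the underlying real Hilbert space may be used.
  · let _ : InnerProductSpace ℝ H := InnerProductSpace.rclikeToReal 𝕜 H
    have := hμ.boundedVariation
    have := hμ.radon.innerRegular
    subst hψ
    exact eq_zero_of_annihilated h₁ h₂ hpoly μ hint h
  · let _ : InnerProductSpace ℝ H := InnerProductSpace.rclikeToReal 𝕜 H
    obtain ⟨p, hp⟩ := hpoly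
    obtain ⟨μ, hne, hrad, hint, hann⟩ := exists_ne_zero_annihilated (E := H) (𝕂 := 𝕂) p
    refine hne (h μ hrad (hint _) fun y c hc => ?_)
    rw [← hann y c]
    congr 1
    funext x
    exact hp _ (by positivity)
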